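/- Let $\mathbb{L}^3$ be the 3-dimensional Minkowski space, that is, $\mathbb{R}^3$ with the metric $g = dx^2+dy^2-dz^2$ and its Levi-Civita connection $\nabla$, and let $K$ be a smooth timelike vector field on $\mathbb{L}^3$ ($g(K_p,K_p)<0$ for all $p$) such that $\nabla K=\alpha\,K^\flat\otimes K$ for some $\alpha\in C^\infty(\mathbb{L}^3)$, i.e. $\nabla_X K=\alpha\, g(K,X)\,K$ for every vector field $X$. Let $$C_K\mathbb{L}^3=\{v\in T\mathbb{L}^3 \mid g(v,v)=0,\ g(v,K_{\pi(v)})=-1\}$$ be the null congruence associated with $K$, where $\pi:T\mathbb{L}^3\to\mathbb{L}^3$ is the projection, endowed with the tensor $\widehat g$ induced from the Sasaki metric $\widehat g(\zeta,\xi)=g(d\pi(\zeta),d\pi(\xi))+g(c(\zeta),c(\xi))$ of $T\mathbb{L}^3$, where $c:TT\mathbb{L}^3\to T\mathbb{L}^3$ is the connection map of $\nabla$. Then: (1) $(C_K\mathbb{L}^3,\widehat g)$ is a (connected, 4-dimensional, smoothly embedded in $T\mathbb{L}^3$) Lorentzian manifold, and it is semi-symmetric: its curvature tensor $R$ satisfies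 $R\cdot R=0$, i.e. $$\widehat g(R(R(X,Y)X_1,X_2)X_3,X_4)+\widehat g(R(X_1,R(X,Y)X_2)X_3,X_4)+\widehat g(R(X_1,X_2)R(X,Y)X_3,X_4)+\widehat g(R(X_1,X_2)X_3,R(X,Y)X_4)=0$$ for all vector fields $X_1,X_2,X_3,X_4,X,Y$ on $C_K\mathbb{L}^3$. (2) If moreover the function $K(K(\alpha))$ is not identically zero, then $(C_K\mathbb{L}^3,\widehat g)$ is not locally symmetric, i.e. the covariant derivative of $R$ with respect to the Levi-Civita connection of $\widehat g$ does not vanish identically. -/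

import Mathlib

open scoped ContDiff

noncomputable section

namespace NullCongruence

/-! ### Semi-Riemannian geometry in coordinates

A semi-Riemannian metric in coordinates `u = (uⁱ)` is given by its matrix of
coefficients `G u i j = g(∂ᵢ, ∂ⱼ)`. -/

section Coordinates

variable {ι : Type} [Fintype ι] [DecidableEq ι]

/-- The partial derivative `∂ᵢ f` at `u`. -/
def partialDeriv (i : ι) (f : (ι → ℝ) → ℝ) (u : ι → ℝ) : ℝ :=
  fderiv ℝ f u (Pi.single i 1)

/-- The value `g_u(X, Y)` of the metric. -/
def metric (G : (ι → ℝ) → Matrix ι ι ℝ) (u X Y : ι → ℝ) : ℝ :=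
  ∑ i, ∑ j, G u i j * X i * Y j

/-- Christoffel symbols of the Levi-Civita connection:
`Γˡᵢⱼ = ½ ∑ₘ gˡᵐ (∂ᵢ gⱼₘ + ∂ⱼ gᵢₘ - ∂ₘ gᵢⱼ)`. -/
def christoffel (G : (ι → ℝ) → Matrix ι ι ℝ) (l i j : ι) (u : ι → ℝ) : ℝ :=
  (1 / 2) * ∑ m, (G u)⁻¹ l m *
    (partialDeriv i (fun w => G w j m) u + partialDeriv j (fun w => G w i m) u
      - partialDeriv m (fun w => G w i j) u)

/-- The vector `Γ(X, Y)` with components `∑ᵢⱼ Γˡᵢⱼ Xⁱ Yʲ`. -/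
def christoffelVec (G : (ι → ℝ) → Matrix ι ι ℝ) (u X Y : ι → ℝ) : ι → ℝ :=
  fun l => ∑ i, ∑ j, christoffel G l i j u * X i * Y j

/-- The Levi-Civita covariant derivative `∇_X Y` at `u`, where `X` is a tangent vector at `u`
and `Y` is a vector field. -/
def covDeriv (G : (ι → ℝ) → Matrix ι ι ℝ) (Y : (ι → ℝ) → (ι → ℝ)) (u X : ι → ℝ) : ι → ℝ :=
  fderiv ℝ Y u X + christoffelVec G u X (Y u)

/-- Components of the curvature tensor, `R(∂ᵢ, ∂ⱼ) ∂ₖ = ∑ₗ Rˡₖᵢⱼ ∂ₗ`, for the convention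
`R(X, Y) Z = ∇_X ∇_Y Z - ∇_Y ∇_X Z - ∇_[X, Y] Z`. -/
def riemann (G : (ι → ℝ) → Matrix ι ι ℝ) (l k i j : ι) (u : ι → ℝ) : ℝ :=
  partialDeriv i (christoffel G l j k) u - partialDeriv j (christoffel G l i k) u
    + ∑ m, (christoffel G l i m u * christoffel G m j k u
      - christoffel G l j m u * christoffel G m i k u)

/-- The vector `R(X, Y) Z` at `u`. -/
def curvature (G : (ι → ℝ) → Matrix ι ι ℝ) (u X Y Z : ι → ℝ) : ι → ℝ :=
  fun l => ∑ k, ∑ i, ∑ j, riemann G l k i j u * X i * Y j * Z k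

/-- The tensor `(R · R)(X₁, X₂, X₃, X₄; X, Y)` at `u`. -/
def curvatureDotCurvature (G : (ι → ℝ) → Matrix ι ι ℝ) (u X₁ X₂ X₃ X₄ X Y : ι → ℝ) : ℝ :=
  - metric G u (curvature G u (curvature G u X Y X₁) X₂ X₃) X₄
  - metric G u (curvature G u X₁ (curvature G u X Y X₂) X₃) X₄
  - metric G u (curvature G u X₁ X₂ (curvature G u X Y X₃)) X₄
  - metric G u (curvature G u X₁ X₂ X₃) (curvature G u X Y X₄)

/-- Components of the covariant derivative of the curvature tensor,
`(∇_{∂ₘ} R)(∂ᵢ, ∂ⱼ) ∂ₖ = ∑ₗ (∇ₘ Rˡₖᵢⱼ) ∂ₗ`. -/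
def covDerivRiemann (G : (ι → ℝ) → Matrix ι ι ℝ) (m l k i j : ι) (u : ι → ℝ) : ℝ :=
  partialDeriv m (riemann G l k i j) u
    + ∑ a, (christoffel G l m a u * riemann G a k i j u
      - christoffel G a m k u * riemann G l a i j u
      - christoffel G a m i u * riemann G l k a j u
      - christoffel G a m j u * riemann G l k i a u)

/-- A symmetric bilinear form, given by its matrix, is nondegenerate of signature
`(-, +, …, +)`. -/
def IsLorentzForm (A : Matrix ι ι ℝ) : Prop :=
  ∃ (P : Matrix ι ι ℝ) (i₀ : ι), IsUnit P.det ∧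
    P.transpose * A * P = Matrix.diagonal (fun i => if i = i₀ then -1 else 1)

end Coordinates

/-! ### Embedded submanifolds carrying an induced symmetric tensor -/

section Submanifold

variable {E : Type} [NormedAddCommGroup E] [NormedSpace ℝ E]

/-- A chart `e` of the subset `C` of `E` (a homeomorphism from a relatively open subset of `C`
onto an open subset of `ℝᵈ`) is a chart of the smooth embedded submanifold `C` if the
parametrization `e⁻¹` is a smooth immersion into `E`. -/
structure IsSubmanifoldChart {d : ℕ} (C : Set E) (e : OpenPartialHomeomorph C (Fin d → ℝ)) :
    Prop where
  smooth : ContDiffOn ℝ ∞ (fun u => (e.symm u : E)) e.target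
  immersion : ∀ u ∈ e.target, Function.Injective (fderiv ℝ (fun w => (e.symm w : E)) u)

/-- Coefficients in the chart `e` of the tensor induced on `C` by a field `h` of bilinear forms
on `E`. -/
def inducedMetric {d : ℕ} (h : E → E → E → ℝ) (C : Set E)
    (e : OpenPartialHomeomorph C (Fin d → ℝ)) (u : Fin d → ℝ) : Matrix (Fin d) (Fin d) ℝ :=
  fun i j => h (e.symm u : E)
    (fderiv ℝ (fun w => (e.symm w : E)) u (Pi.single i 1))
    (fderiv ℝ (fun w => (e.symm w : E)) u (Pi.single j 1))

/-- `C`, with the tensor induced by `h`, is a (connected) Lorentzian manifold of dimension `d`,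
smoothly embedded in `E`. -/
structure IsLorentzianSubmanifold (d : ℕ) (h : E → E → E → ℝ) (C : Set E) : Prop where
  connected : IsConnected C
  exists_chart : ∀ x : C, ∃ e : OpenPartialHomeomorph C (Fin d → ℝ),
    IsSubmanifoldChart C e ∧ x ∈ e.source
  smooth_metric : ∀ e : OpenPartialHomeomorph C (Fin d → ℝ), IsSubmanifoldChart C e →
    ∀ i j, ContDiffOn ℝ ∞ (fun u => inducedMetric h C e u i j) e.target
  lorentz : ∀ e : OpenPartialHomeomorph C (Fin d → ℝ), IsSubmanifoldChart C e →
    ∀ u ∈ e.target, IsLorentzForm (inducedMetric h C e u)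

/-- `R · R = 0` for the metric induced on `C` by `h`. -/
def IsSemiSymmetric (d : ℕ) (h : E → E → E → ℝ) (C : Set E) : Prop :=
  ∀ e : OpenPartialHomeomorph C (Fin d → ℝ), IsSubmanifoldChart C e → ∀ u ∈ e.target,
    ∀ X₁ X₂ X₃ X₄ X Y : Fin d → ℝ,
      curvatureDotCurvature (inducedMetric h C e) u X₁ X₂ X₃ X₄ X Y = 0

/-- `∇R = 0` for the metric induced on `C` by `h`. -/
def IsLocallySymmetric (d : ℕ) (h : E → E → E → ℝ) (C : Set E) : Prop :=
  ∀ e : OpenPartialHomeomorph C (Fin d → ℝ), IsSubmanifoldChart C e → ∀ u ∈ e.target,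
    ∀ m l k i j : Fin d, covDerivRiemann (inducedMetric h C e) m l k i j u = 0

end Submanifold

/-! ### The tangent bundle, the Sasaki metric and null congruences

For a metric `G` on `M = ℝⁿ`, the tangent bundle is `TM = ℝⁿ × ℝⁿ`, with points `(p, v)`,
`v ∈ T_p M`, and the tangent vectors of `TM` at `(p, v)` are the pairs `ζ = (ζ.1, ζ.2)`, with
`dπ(ζ) = ζ.1`. -/

section TangentBundle

variable {ι : Type} [Fintype ι] [DecidableEq ι]

/-- The connection map `c : TTM → TM`: for a curve `t ↦ (p(t), v(t))` with velocity `ζ`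
it is the covariant derivative of `v` along `p`, that is, `v' + Γ(p', v)`. -/
def connector (G : (ι → ℝ) → Matrix ι ι ℝ) (z ζ : (ι → ℝ) × (ι → ℝ)) : ι → ℝ :=
  ζ.2 + christoffelVec G z.1 ζ.1 z.2

/-- The Sasaki metric `ĝ(ζ, ξ) = g(dπ ζ, dπ ξ) + g(c ζ, c ξ)` at `z ∈ TM`. -/
def sasaki (G : (ι → ℝ) → Matrix ι ι ℝ) (z ζ ξ : (ι → ℝ) × (ι → ℝ)) : ℝ :=
  metric G z.1 ζ.1 ξ.1 + metric G z.1 (connector G z ζ) (connector G z ξ)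

/-- The null congruence `C_K M = {v ∈ TM | g(v, v) = 0, g(v, K) = -1}`. -/
def nullCongruence (G : (ι → ℝ) → Matrix ι ι ℝ) (K : (ι → ℝ) → (ι → ℝ)) :
    Set ((ι → ℝ) × (ι → ℝ)) :=
  {z | metric G z.1 z.2 z.2 = 0 ∧ metric G z.1 z.2 (K z.1) = -1}

/-- The function `K(f)`, the derivative of `f` along the vector field `K`. -/
def vectorFieldAct (K : (ι → ℝ) → (ι → ℝ)) (f : (ι → ℝ) → ℝ) : (ι → ℝ) → ℝ :=
  fun p => fderiv ℝ f p (K p)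

end TangentBundle

/-- The metric `dx² + dy² - dz²` of the Minkowski space `𝕃³`. -/
def minkowski : (Fin 3 → ℝ) → Matrix (Fin 3) (Fin 3) ℝ :=
  fun _ => Matrix.diagonal ![1, 1, -1]

end NullCongruence

end

/-! The equation for `K` says that all components of `K` have the same logarithmic derivative,
namely `α K♭`, and so does `S = √(-g(K, K))`. Hence `K / S` is a constant unit timelike vector `T`.
In an orthonormal frame whose last vector is `T`, with time coordinate `t`, the function `1 / S` has
differential `α dt`. So it is `f(t)` with `f' = α`, and `K = (1 / f(t)) ∂ₜ`
(`exists_frame_of_recurrent`).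

In this frame the null congruence consists of the vectors `f(t) (cos θ, sin θ, 1)`
(`IsAdapted.mem_iff`). Since the connection is flat, the Sasaki metric restricts to `dx² + dy² - dt²
+ d(f cos θ)² + d(f sin θ)² - df² = dx² + dy² - dt² + f² dθ²`, the product of a Euclidean plane and
a warped Lorentzian surface. Its curvature tensor is therefore a function times `Ω ⊗ Ω` with `Ω = dt
∧ dθ`. Each `R(X, Y)` is skew for the metric and annihilates `Ω`, which gives `R · R = 0`.

The surface has curvature `f'' / f` up to sign, and `K(α) = f'' / f`. Hence `K(K(α)) = (f f''' - f'
f'') / f³` is the derivative of this curvature divided by `f`. Where it is nonzero, a component of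
`∇R` is nonzero.

The definitions quantify over every submanifold chart, so the metric is handled through the closed
coframe `dx, dy, dt, dθ`, which makes sense in any chart (`IsWarpedCoframe`,
`IsAdapted.isWarpedCoframe`). Explicit angular charts serve only to cover the congruence and to
exhibit `∇R ≠ 0`. -/

noncomputable section

namespace NullCongruence

open Filter Topology

set_option linter.unusedSectionVars false

/-! ### Calculus of partial derivatives. -/

section PartialDeriv

variable {ι : Type} [Fintype ι] [DecidableEq ι] {f g : (ι → ℝ) → ℝ} {u : ι → ℝ}

lemma partialDeriv_congr (h : f =ᶠ[𝓝 u] g) (i : ι) : partialDeriv i f u = partialDeriv i g u := by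
  rw [partialDeriv, partialDeriv, h.fderiv_eq]

lemma partialDeriv_const (i : ι) (c : ℝ) : partialDeriv i (fun _ => c) u = 0 := by
  simp [partialDeriv]

lemma partialDeriv_add (hf : DifferentiableAt ℝ f u) (hg : DifferentiableAt ℝ g u) (i : ι) :
    partialDeriv i (fun w => f w + g w) u = partialDeriv i f u + partialDeriv i g u := by
  simp [partialDeriv, fderiv_fun_add hf hg]

lemma partialDeriv_sub (hf : DifferentiableAt ℝ f u) (hg : DifferentiableAt ℝ g u) (i : ι) :
    partialDeriv i (fun w => f w - g w) u = partialDeriv i f u - partialDeriv i g u := by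
  simp [partialDeriv, fderiv_fun_sub hf hg]

lemma partialDeriv_mul (hf : DifferentiableAt ℝ f u) (hg : DifferentiableAt ℝ g u) (i : ι) :
    partialDeriv i (fun w => f w * g w) u
      = partialDeriv i f u * g u + f u * partialDeriv i g u := by
  simp [partialDeriv, fderiv_fun_mul hf hg]; ring

lemma partialDeriv_div (hf : DifferentiableAt ℝ f u) (hg : DifferentiableAt ℝ g u)
    (h0 : g u ≠ 0) (i : ι) :
    partialDeriv i (fun w => f w / g w) u
      = (partialDeriv i f u * g u - f u * partialDeriv i g u) / g u ^ 2 := by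
  have hq : DifferentiableAt ℝ (fun w => f w / g w) u := by fun_prop (disch := exact h0)
  have he : f =ᶠ[𝓝 u] fun w => f w / g w * g w := by
    filter_upwards [hg.continuousAt.eventually_ne h0] with w hw
    field_simp
  have := partialDeriv_congr he i
  rw [partialDeriv_mul hq hg] at this
  rw [this]
  field_simp
  ring

lemma partialDeriv_sum {κ : Type} (s : Finset κ) {F : κ → (ι → ℝ) → ℝ}
    (hF : ∀ k, DifferentiableAt ℝ (F k) u) (i : ι) :
    partialDeriv i (fun w => ∑ k ∈ s, F k w) u = ∑ k ∈ s, partialDeriv i (F k) u := by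
  simp [partialDeriv, fderiv_fun_sum (fun k _ => hF k)]

lemma partialDeriv_comp {φ : ℝ → ℝ} (hφ : DifferentiableAt ℝ φ (f u))
    (hf : DifferentiableAt ℝ f u) (i : ι) :
    partialDeriv i (fun w => φ (f w)) u = deriv φ (f u) * partialDeriv i f u := by
  have := (hφ.hasDerivAt.comp_hasFDerivAt u hf.hasFDerivAt).fderiv
  simp only [Function.comp_def] at this
  simp [partialDeriv, this]

lemma partialDeriv_apply (i j : ι) : partialDeriv i (fun w : ι → ℝ => w j) u
    = (Pi.single i 1 : ι → ℝ) j := by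
  rw [partialDeriv, show (fun w : ι → ℝ => w j) = ContinuousLinearMap.proj (R := ℝ) j from rfl,
    ContinuousLinearMap.fderiv]
  simp

lemma contDiffAt_partialDeriv (hf : ContDiffAt ℝ ∞ f u) (i : ι) :
    ContDiffAt ℝ ∞ (partialDeriv i f) u :=
  (hf.fderiv_right (m := ∞) (by simp)).clm_apply contDiffAt_const

lemma partialDeriv_comm (hf : ContDiffAt ℝ ∞ f u) (i j : ι) :
    partialDeriv i (partialDeriv j f) u = partialDeriv j (partialDeriv i f) u := by
  have hd : DifferentiableAt ℝ (fderiv ℝ f) u :=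
    (hf.fderiv_right (m := ∞) (by simp)).differentiableAt (by simp)
  have key : ∀ a b : ι, partialDeriv a (partialDeriv b f) u
      = fderiv ℝ (fderiv ℝ f) u (Pi.single a 1) (Pi.single b 1) := by
    intro a b
    have := (hd.hasFDerivAt.clm_apply (hasFDerivAt_const (Pi.single b 1 : ι → ℝ) u)).fderiv
    simp only [partialDeriv]
    change fderiv ℝ (fun y => fderiv ℝ f y (Pi.single b 1)) u _ = _
    rw [this]; simp
  rw [key, key]
  exact (hf.isSymmSndFDerivAt (by simpa using WithTop.coe_le_coe.2 (le_top : (2 : ℕ∞) ≤ ⊤))).eq _ _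

end PartialDeriv

/-! ### Christoffel symbols, the Ricci identity and `R · R` in coordinates. -/

section Curvature

variable {ι : Type} [Fintype ι] [DecidableEq ι] {G : (ι → ℝ) → Matrix ι ι ℝ} {u : ι → ℝ}

lemma sum_metric_mul_christoffel (hG : IsUnit (G u).det) (a i j : ι) :
    ∑ l, G u a l * christoffel G l i j u = (1 / 2) *
      (partialDeriv i (fun w => G w j a) u + partialDeriv j (fun w => G w i a) u
      - partialDeriv a (fun w => G w i j) u) := by
  set S : ι → ℝ := fun m => partialDeriv i (fun w => G w j m) u
    + partialDeriv j (fun w => G w i m) u - partialDeriv m (fun w => G w i j) u with hS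
  have h : (fun l => christoffel G l i j u) = (1 / 2 : ℝ) • (G u)⁻¹.mulVec S := by
    ext l; simp [christoffel, Matrix.mulVec, dotProduct, hS]
  have h2 : (G u).mulVec (fun l => christoffel G l i j u) = (1 / 2 : ℝ) • S := by
    rw [h, Matrix.mulVec_smul, Matrix.mulVec_mulVec, Matrix.mul_nonsing_inv _ hG,
      Matrix.one_mulVec]
  have := congrFun h2 a
  simpa [Matrix.mulVec, dotProduct, hS] using this

lemma contDiffAt_det {M : (ι → ℝ) → Matrix ι ι ℝ} (hM : ∀ i j, ContDiffAt ℝ ∞ (fun w => M w i j) u) :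
    ContDiffAt ℝ ∞ (fun w => (M w).det) u := by
  simp only [Matrix.det_apply]
  exact ContDiffAt.sum fun σ _ => (contDiffAt_prod fun i _ => hM _ _).const_smul _

lemma contDiffAt_inv_apply (hG : IsUnit (G u).det)
    (hs : ∀ i j, ContDiffAt ℝ ∞ (fun w => G w i j) u) (i j : ι) :
    ContDiffAt ℝ ∞ (fun w => (G w)⁻¹ i j) u := by
  simp only [Matrix.inv_def, Matrix.smul_apply, Ring.inverse_eq_inv', Matrix.adjugate_apply,
    smul_eq_mul]
  refine ((contDiffAt_det hs).inv hG.ne_zero).mul (contDiffAt_det fun k l => ?_)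
  by_cases h : k = j
  · subst h; simp only [Matrix.updateRow_self]; exact contDiffAt_const
  · simp only [Matrix.updateRow_ne h]; exact hs _ _

lemma contDiffAt_christoffel (hG : IsUnit (G u).det)
    (hs : ∀ i j, ContDiffAt ℝ ∞ (fun w => G w i j) u) (l i j : ι) :
    ContDiffAt ℝ ∞ (christoffel G l i j) u := by
  unfold christoffel
  refine contDiffAt_const.mul (ContDiffAt.sum fun m _ => (contDiffAt_inv_apply hG hs l m).mul ?_)
  exact ((contDiffAt_partialDeriv (hs _ _) _).add (contDiffAt_partialDeriv (hs _ _) _)).sub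
    (contDiffAt_partialDeriv (hs _ _) _)

/-- The Ricci identity for a closed one-form `a` with `∇a = -B`. -/
lemma sum_mul_riemann {a : ι → (ι → ℝ) → ℝ} {B : ι → ι → (ι → ℝ) → ℝ}
    (ha : ∀ i, ContDiffAt ℝ ∞ (a i) u) (hB : ∀ i j, DifferentiableAt ℝ (B i j) u)
    (hΓ : ∀ l i j, DifferentiableAt ℝ (christoffel G l i j) u)
    (h : ∀ i j, (fun w => ∑ l, a l w * christoffel G l i j w)
      =ᶠ[𝓝 u] fun w => partialDeriv i (a j) w + B i j w) (k i j : ι) :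
    ∑ l, a l u * riemann G l k i j u = partialDeriv i (B j k) u - partialDeriv j (B i k) u
      + ∑ m, (B i m u * christoffel G m j k u - B j m u * christoffel G m i k u) := by
  have hd : ∀ l, DifferentiableAt ℝ (a l) u := fun l => (ha l).differentiableAt (by simp)
  have hdd : ∀ i l, DifferentiableAt ℝ (partialDeriv i (a l)) u :=
    fun i l => (contDiffAt_partialDeriv (ha l) i).differentiableAt (by simp)
  -- The hypothesis differentiated along `i`. Subtracting the version with `i` and `j` exchanged
  -- cancels the second derivatives of `a` and leaves the derivative part of the curvature.
  have key : ∀ i j k, ∑ l, (partialDeriv i (a l) u * christoffel G l j k u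
      + a l u * partialDeriv i (christoffel G l j k) u)
      = partialDeriv i (partialDeriv j (a k)) u + partialDeriv i (B j k) u := by
    intro i j k
    rw [← partialDeriv_add (hdd _ _) (hB _ _), ← partialDeriv_congr (h j k),
      partialDeriv_sum _ (F := fun l w => a l w * christoffel G l j k w)
        (fun l => (hd l).mul (hΓ l j k))]
    exact Finset.sum_congr rfl fun l _ => (partialDeriv_mul (hd l) (hΓ l j k) i).symm
  have hcom : partialDeriv i (partialDeriv j (a k)) u = partialDeriv j (partialDeriv i (a k)) u :=
    partialDeriv_comm (ha k) i j
  have h1 := key i j k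
  have h2 := key j i k
  have h3 : ∀ i j k, ∑ m, (∑ l, a l u * christoffel G l i m u) * christoffel G m j k u
      = ∑ m, (partialDeriv i (a m) u + B i m u) * christoffel G m j k u := fun i j k =>
    Finset.sum_congr rfl fun m _ => congrArg (· * _) (h i m).self_of_nhds
  have h4 : ∀ i j k, ∑ m, (∑ l, a l u * christoffel G l i m u) * christoffel G m j k u
      = ∑ l, a l u * ∑ m, christoffel G l i m u * christoffel G m j k u := by
    intro i j k
    simp only [Finset.sum_mul, Finset.mul_sum]
    rw [Finset.sum_comm]
    simp only [mul_assoc]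
  have h5 := h3 i j k
  have h6 := h3 j i k
  rw [h4] at h5 h6
  simp only [riemann, mul_add, mul_sub, Finset.sum_add_distrib, Finset.sum_sub_distrib,
    add_mul] at h1 h2 h5 h6 ⊢
  linarith

/-- `R · R = 0` when the curvature tensor is a multiple of `Ω ⊗ Ω` for a two-form `Ω`. -/
lemma curvatureDotCurvature_eq_zero (hG : IsUnit (G u).det) (hsymm : ∀ i j, G u i j = G u j i)
    {c : ℝ} {Ω : ι → ι → ℝ} (hΩ : ∀ i j, Ω i j = - Ω j i)
    (hR : ∀ a k i j, ∑ l, G u a l * riemann G l k i j u = c * (Ω i j * Ω k a))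
    (X₁ X₂ X₃ X₄ X Y : ι → ℝ) : curvatureDotCurvature G u X₁ X₂ X₃ X₄ X Y = 0 := by
  set O : (ι → ℝ) → (ι → ℝ) → ℝ := fun X Y => ∑ i, ∑ j, Ω i j * X i * Y j with hO
  have hanti : ∀ X Y, O X Y = - O Y X := by
    intro X Y
    simp only [hO]
    rw [Finset.sum_comm, ← Finset.sum_neg_distrib]
    refine Finset.sum_congr rfl fun i _ => ?_
    rw [← Finset.sum_neg_distrib]
    refine Finset.sum_congr rfl fun j _ => ?_
    rw [hΩ j i]; ring
  have hmsymm : ∀ X Y, metric G u X Y = metric G u Y X := by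
    intro X Y
    simp only [metric]
    rw [Finset.sum_comm]
    refine Finset.sum_congr rfl fun i _ => Finset.sum_congr rfl fun j _ => ?_
    rw [hsymm j i]; ring
  have hm : ∀ X Y Z W, metric G u (curvature G u X Y Z) W = c * O X Y * O Z W := by
    intro X Y Z W
    have e1 : metric G u W (curvature G u X Y Z)
        = ∑ a, ∑ k, ∑ i, ∑ j, (∑ l, G u a l * riemann G l k i j u) * (X i * Y j * Z k * W a) := by
      simp only [metric, curvature, Finset.mul_sum, Finset.sum_mul]
      refine Finset.sum_congr rfl fun a _ => ?_
      rw [Finset.sum_comm]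
      refine Finset.sum_congr rfl fun k _ => ?_
      rw [Finset.sum_comm]
      refine Finset.sum_congr rfl fun i _ => ?_
      rw [Finset.sum_comm]
      refine Finset.sum_congr rfl fun j _ => Finset.sum_congr rfl fun l _ => ?_
      ring
    have e2 : ∀ a k, ∑ i, ∑ j, (∑ l, G u a l * riemann G l k i j u) * (X i * Y j * Z k * W a)
        = c * O X Y * (Ω k a * Z k * W a) := by
      intro a k
      simp only [hR, hO, Finset.mul_sum, Finset.sum_mul]
      exact Finset.sum_congr rfl fun i _ => Finset.sum_congr rfl fun j _ => by ring
    rw [hmsymm, e1, Finset.sum_comm]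
    simp only [e2]
    simp only [← Finset.mul_sum, hO]
  have hnd : ∀ Z, (∀ W, metric G u Z W = 0) → Z = 0 := by
    intro Z hZ
    refine Matrix.mulVec_injective_of_isUnit ((Matrix.isUnit_iff_isUnit_det _).2 hG) ?_
    ext a
    have := hZ (Pi.single a 1)
    rw [hmsymm] at this
    simpa [metric, Matrix.mulVec, dotProduct, Pi.single_apply] using this
  -- `R(X, Y)` acts on `Ω` as a derivation with value zero. By `hm`, `g(R Z, R W)` equals both `c
  -- O(X, Y) O(Z, R W)` and `c O(X, Y) O(W, R Z)`. If the factor `c O(X, Y)` vanishes, nondegeneracy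
  -- gives `R(X, Y) = 0` instead.
  have hbr : ∀ Z W, O (curvature G u X Y Z) W + O Z (curvature G u X Y W) = 0 := by
    intro Z W
    by_cases h0 : c * O X Y = 0
    · have hz : ∀ Z, curvature G u X Y Z = 0 := fun Z => hnd _ fun W => by rw [hm, h0, zero_mul]
      simp [hz, hO]
    · have h1 := hm X Y Z (curvature G u X Y W)
      have h2 := hm X Y W (curvature G u X Y Z)
      rw [hmsymm, h1, hanti W] at h2
      refine (mul_eq_zero.1 ?_).resolve_left h0
      linear_combination h2
  simp only [curvatureDotCurvature, hm]
  linear_combination (-c * O X₃ X₄) * hbr X₁ X₂ - (c * O X₁ X₂) * hbr X₃ X₄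

end Curvature

/-! ### Curvature of a warped metric given by a closed coframe. -/

/-- On the open set `U` the metric is `(a⁰)² + (a¹)² - (a²)² + r² (a³)²` for closed one-forms
`aᶜ = ∑ᵢ A c i duⁱ`, where `dr = r' a²` and `dr' = r'' a²`. -/
structure IsWarpedCoframe (U : Set (Fin 4 → ℝ)) (G : (Fin 4 → ℝ) → Matrix (Fin 4) (Fin 4) ℝ)
    (A : Fin 4 → Fin 4 → (Fin 4 → ℝ) → ℝ) (r r' r'' : (Fin 4 → ℝ) → ℝ) : Prop where
  isOpen : IsOpen U
  smooth : ∀ u ∈ U, ∀ c i, ContDiffAt ℝ ∞ (A c i) u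
  smooth_r : ∀ u ∈ U, ContDiffAt ℝ ∞ r u
  smooth_r' : ∀ u ∈ U, ContDiffAt ℝ ∞ r' u
  pos : ∀ u ∈ U, 0 < r u
  closed : ∀ u ∈ U, ∀ c i j, partialDeriv i (A c j) u = partialDeriv j (A c i) u
  deriv_r : ∀ u ∈ U, ∀ i, partialDeriv i r u = r' u * A 2 i u
  deriv_r' : ∀ u ∈ U, ∀ i, partialDeriv i r' u = r'' u * A 2 i u
  indep : ∀ u ∈ U, IsUnit (Matrix.of fun c i => A c i u).det
  metric_eq : ∀ u ∈ U, ∀ i j, G u i j = A 0 i u * A 0 j u + A 1 i u * A 1 j u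
    - A 2 i u * A 2 j u + r u ^ 2 * (A 3 i u * A 3 j u)

namespace IsWarpedCoframe

variable {U : Set (Fin 4 → ℝ)} {G : (Fin 4 → ℝ) → Matrix (Fin 4) (Fin 4) ℝ}
  {A : Fin 4 → Fin 4 → (Fin 4 → ℝ) → ℝ} {r r' r'' : (Fin 4 → ℝ) → ℝ} {u : Fin 4 → ℝ}

lemma matrix_eq (h : IsWarpedCoframe U G A r r' r'') (hu : u ∈ U) :
    G u = (Matrix.of fun c i => A c i u).transpose * Matrix.diagonal ![1, 1, -1, r u ^ 2]
      * Matrix.of fun c i => A c i u := by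
  ext i j
  rw [h.metric_eq u hu, Matrix.mul_apply]
  simp [Matrix.mul_diagonal, Fin.sum_univ_four]
  ring

lemma isUnit_det (h : IsWarpedCoframe U G A r r' r'') (hu : u ∈ U) : IsUnit (G u).det := by
  have h1 := (h.indep u hu).ne_zero
  have h2 := (h.pos u hu).ne'
  rw [h.matrix_eq hu, Matrix.det_mul, Matrix.det_mul, Matrix.det_transpose, Matrix.det_diagonal]
  refine IsUnit.mk0 _ (mul_ne_zero (mul_ne_zero h1 ?_) h1)
  simp [Fin.prod_univ_four, h2]

lemma isLorentzForm (h : IsWarpedCoframe U G A r r' r'') (hu : u ∈ U) : IsLorentzForm (G u) := by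
  have h1 := h.indep u hu
  have h2 := (h.pos u hu).ne'
  set M : Matrix (Fin 4) (Fin 4) ℝ := Matrix.of fun c i => A c i u with hM
  set D : Matrix (Fin 4) (Fin 4) ℝ := Matrix.diagonal ![1, 1, 1, (r u)⁻¹] with hD
  -- The columns of `M⁻¹` form the dual frame. `D` rescales its last vector, of length `r`, and
  -- index 2 is the timelike one.
  refine ⟨M⁻¹ * D, 2, ?_, ?_⟩
  · rw [Matrix.det_mul, Matrix.det_diagonal]
    refine ((Matrix.isUnit_nonsing_inv_det _ h1)).mul (IsUnit.mk0 _ ?_)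
    simp [Fin.prod_univ_four, h2]
  · have e1 : M * (M⁻¹ * D) = D := by rw [← mul_assoc, Matrix.mul_nonsing_inv _ h1, one_mul]
    rw [h.matrix_eq hu, mul_assoc, mul_assoc, mul_assoc, e1, ← mul_assoc, ← Matrix.transpose_mul,
      e1, hD, Matrix.diagonal_transpose, Matrix.diagonal_mul_diagonal, Matrix.diagonal_mul_diagonal]
    congr 1
    ext i
    fin_cases i <;> simp
    field_simp

lemma metric_symm (h : IsWarpedCoframe U G A r r' r'') (hu : u ∈ U) (i j : Fin 4) :
    G u i j = G u j i := by
  rw [h.metric_eq u hu, h.metric_eq u hu]; ring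

lemma eventually_mem (h : IsWarpedCoframe U G A r r' r'') (hu : u ∈ U) : ∀ᶠ w in 𝓝 u, w ∈ U :=
  h.isOpen.mem_nhds hu

lemma contDiffAt_metric (h : IsWarpedCoframe U G A r r' r'') (hu : u ∈ U) (i j : Fin 4) :
    ContDiffAt ℝ ∞ (fun w => G w i j) u := by
  have hs := h.smooth u hu
  have hr := h.smooth_r u hu
  refine ContDiffAt.congr_of_eventuallyEq (f := fun w => A 0 i w * A 0 j w + A 1 i w * A 1 j w
    - A 2 i w * A 2 j w + r w ^ 2 * (A 3 i w * A 3 j w)) ?_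
    ((h.eventually_mem hu).mono fun w hw => h.metric_eq w hw i j)
  exact ((((hs 0 i).mul (hs 0 j)).add ((hs 1 i).mul (hs 1 j))).sub ((hs 2 i).mul (hs 2 j))).add
    ((hr.pow 2).mul ((hs 3 i).mul (hs 3 j)))

lemma partialDeriv_metric (h : IsWarpedCoframe U G A r r' r'') (hu : u ∈ U) (k i j : Fin 4) :
    partialDeriv k (fun w => G w i j) u
      = partialDeriv k (A 0 i) u * A 0 j u + A 0 i u * partialDeriv k (A 0 j) u
      + (partialDeriv k (A 1 i) u * A 1 j u + A 1 i u * partialDeriv k (A 1 j) u)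
      - (partialDeriv k (A 2 i) u * A 2 j u + A 2 i u * partialDeriv k (A 2 j) u)
      + 2 * r u * r' u * A 2 k u * (A 3 i u * A 3 j u)
      + r u ^ 2 * (partialDeriv k (A 3 i) u * A 3 j u + A 3 i u * partialDeriv k (A 3 j) u) := by
  have hs : ∀ c i, DifferentiableAt ℝ (A c i) u :=
    fun c i => (h.smooth u hu c i).differentiableAt (by simp)
  have hr : DifferentiableAt ℝ r u := (h.smooth_r u hu).differentiableAt (by simp)
  have e : (fun w => G w i j) =ᶠ[𝓝 u] fun w => A 0 i w * A 0 j w + A 1 i w * A 1 j w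
    - A 2 i w * A 2 j w + (r w * r w) * (A 3 i w * A 3 j w) :=
    (h.eventually_mem hu).mono fun w hw => by
      have := h.metric_eq w hw i j
      simp only [this]; ring
  have hm : ∀ c, DifferentiableAt ℝ (fun w => A c i w * A c j w) u :=
    fun c => (hs c i).mul (hs c j)
  have hrr : DifferentiableAt ℝ (fun w => r w * r w) u := hr.mul hr
  rw [partialDeriv_congr e, partialDeriv_add (((hm 0).fun_add (hm 1)).fun_sub (hm 2)) (hrr.fun_mul (hm 3)),
    partialDeriv_sub ((hm 0).fun_add (hm 1)) (hm 2), partialDeriv_add (hm 0) (hm 1),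
    partialDeriv_mul hrr (hm 3), partialDeriv_mul hr hr, partialDeriv_mul (hs _ _) (hs _ _),
    partialDeriv_mul (hs _ _) (hs _ _), partialDeriv_mul (hs _ _) (hs _ _),
    partialDeriv_mul (hs _ _) (hs _ _), h.deriv_r u hu]
  ring

/-- Minus the covariant derivatives of the one-forms of a warped coframe. -/
def negHessian (A : Fin 4 → Fin 4 → (Fin 4 → ℝ) → ℝ) (r r' : (Fin 4 → ℝ) → ℝ) (c i j : Fin 4)
    (w : Fin 4 → ℝ) : ℝ :=
  ![0, 0, r w * r' w * (A 3 i w * A 3 j w),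
    r' w / r w * (A 2 i w * A 3 j w + A 2 j w * A 3 i w)] c

/-- The Koszul formula determines the Christoffel symbols, so the expected values need only be
checked against it. Closedness makes all derivatives of the coframe collapse to `∂ᵢ aⱼ`, and the
rest comes from `d(r²) = 2 r r' a²`. -/
lemma sum_mul_christoffel (h : IsWarpedCoframe U G A r r' r'') (hu : u ∈ U) (c i j : Fin 4) :
    ∑ l, A c l u * christoffel G l i j u
      = partialDeriv i (A c j) u + negHessian A r r' c i j u := by
  set y : Fin 4 → ℝ := fun c => ∑ l, A c l u * christoffel G l i j u
      - (partialDeriv i (A c j) u + negHessian A r r' c i j u) with hy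
  have hr := (h.pos u hu).ne'
  -- The errors `y c`, weighted by the diagonal metric, are the coefficients of a vanishing
  -- combination of the coframe. By independence of the coframe they are zero.
  have key : Matrix.vecMul ![y 0, y 1, -y 2, r u ^ 2 * y 3] (Matrix.of fun c i => A c i u)
      = 0 := by
    ext a
    have h1 := sum_metric_mul_christoffel (h.isUnit_det hu) a i j
    rw [h.partialDeriv_metric hu, h.partialDeriv_metric hu, h.partialDeriv_metric hu,
      h.closed u hu 0 j i, h.closed u hu 1 j i, h.closed u hu 2 j i, h.closed u hu 3 j i,
      h.closed u hu 0 a i, h.closed u hu 1 a i, h.closed u hu 2 a i, h.closed u hu 3 a i,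
      h.closed u hu 0 a j, h.closed u hu 1 a j, h.closed u hu 2 a j, h.closed u hu 3 a j] at h1
    simp only [Fin.sum_univ_four, h.metric_eq u hu] at h1
    simp [Matrix.vecMul, dotProduct, Fin.sum_univ_four, hy, negHessian]
    field_simp
    linear_combination h1
  have h0 := Matrix.vecMul_injective_of_isUnit ((Matrix.isUnit_iff_isUnit_det _).2 (h.indep u hu))
    (key.trans (Matrix.zero_vecMul _).symm)
  have h3 : ∀ c, y c = 0 := by
    intro c
    have := congrFun h0 c
    fin_cases c <;> simpa [hr] using this
  have := h3 c
  simp only [hy] at this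
  linarith

lemma differentiableAt_negHessian (h : IsWarpedCoframe U G A r r' r'') (hu : u ∈ U)
    (c i j : Fin 4) : DifferentiableAt ℝ (negHessian A r r' c i j) u := by
  have hs : ∀ c i, DifferentiableAt ℝ (A c i) u :=
    fun c i => (h.smooth u hu c i).differentiableAt (by simp)
  have hr : DifferentiableAt ℝ r u := (h.smooth_r u hu).differentiableAt (by simp)
  have hr' : DifferentiableAt ℝ r' u := (h.smooth_r' u hu).differentiableAt (by simp)
  have h0 := (h.pos u hu).ne'
  have hq : DifferentiableAt ℝ (fun w => r' w / r w) u := by fun_prop (disch := exact h0)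
  have h2 : DifferentiableAt ℝ (fun w => r w * r' w * (A 3 i w * A 3 j w)) u :=
    (hr.mul hr').mul ((hs _ _).mul (hs _ _))
  have h3 : DifferentiableAt ℝ
      (fun w => r' w / r w * (A 2 i w * A 3 j w + A 2 j w * A 3 i w)) u :=
    hq.mul (((hs _ _).mul (hs _ _)).add ((hs _ _).mul (hs _ _)))
  fin_cases c
  · exact differentiableAt_const 0
  · exact differentiableAt_const 0
  · exact h2
  · exact h3

lemma partialDeriv_negHessian_two (h : IsWarpedCoframe U G A r r' r'') (hu : u ∈ U)
    (k i j : Fin 4) : partialDeriv k (negHessian A r r' 2 i j) u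
      = (r' u ^ 2 + r u * r'' u) * A 2 k u * (A 3 i u * A 3 j u)
      + r u * r' u * (partialDeriv k (A 3 i) u * A 3 j u + A 3 i u * partialDeriv k (A 3 j) u) := by
  have hs : ∀ c i, DifferentiableAt ℝ (A c i) u :=
    fun c i => (h.smooth u hu c i).differentiableAt (by simp)
  have hr : DifferentiableAt ℝ r u := (h.smooth_r u hu).differentiableAt (by simp)
  have hr' : DifferentiableAt ℝ r' u := (h.smooth_r' u hu).differentiableAt (by simp)
  change partialDeriv k (fun w => r w * r' w * (A 3 i w * A 3 j w)) u = _
  rw [partialDeriv_mul (hr.fun_mul hr') ((hs _ _).fun_mul (hs _ _)), partialDeriv_mul hr hr',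
    partialDeriv_mul (hs _ _) (hs _ _), h.deriv_r u hu, h.deriv_r' u hu]
  ring

lemma partialDeriv_negHessian_three (h : IsWarpedCoframe U G A r r' r'') (hu : u ∈ U)
    (k i j : Fin 4) : partialDeriv k (negHessian A r r' 3 i j) u
      = (r'' u * r u - r' u ^ 2) / r u ^ 2 * A 2 k u * (A 2 i u * A 3 j u + A 2 j u * A 3 i u)
      + r' u / r u * (partialDeriv k (A 2 i) u * A 3 j u + A 2 i u * partialDeriv k (A 3 j) u
        + (partialDeriv k (A 2 j) u * A 3 i u + A 2 j u * partialDeriv k (A 3 i) u)) := by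
  have hs : ∀ c i, DifferentiableAt ℝ (A c i) u :=
    fun c i => (h.smooth u hu c i).differentiableAt (by simp)
  have hr : DifferentiableAt ℝ r u := (h.smooth_r u hu).differentiableAt (by simp)
  have hr' : DifferentiableAt ℝ r' u := (h.smooth_r' u hu).differentiableAt (by simp)
  have h0 := (h.pos u hu).ne'
  have hm : ∀ i j, DifferentiableAt ℝ (fun w => A 2 i w * A 3 j w) u :=
    fun i j => (hs _ _).mul (hs _ _)
  have hq : DifferentiableAt ℝ (fun w => r' w / r w) u := by fun_prop (disch := exact h0)
  change partialDeriv k (fun w => r' w / r w * (A 2 i w * A 3 j w + A 2 j w * A 3 i w)) u = _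
  rw [partialDeriv_mul hq ((hm _ _).fun_add (hm _ _)), partialDeriv_div hr' hr h0,
    partialDeriv_add (hm _ _) (hm _ _), partialDeriv_mul (hs _ _) (hs _ _),
    partialDeriv_mul (hs _ _) (hs _ _), h.deriv_r u hu, h.deriv_r' u hu]
  ring

/-- The components of the two-form `a² ∧ a³`. -/
def wedge (A : Fin 4 → Fin 4 → (Fin 4 → ℝ) → ℝ) (i j : Fin 4) (w : Fin 4 → ℝ) : ℝ :=
  A 2 i w * A 3 j w - A 2 j w * A 3 i w

/-- This is the Ricci identity applied to each form of the coframe. The first two forms are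
parallel, and the derivative terms left over for the other two are removed with
`sum_mul_christoffel`. -/
lemma sum_mul_riemann (h : IsWarpedCoframe U G A r r' r'') (hu : u ∈ U) (c k i j : Fin 4) :
    ∑ l, A c l u * riemann G l k i j u = wedge A i j u *
      ![0, 0, r u * r'' u * A 3 k u, r'' u / r u * A 2 k u] c := by
  have hG := h.isUnit_det hu
  have h0 := (h.pos u hu).ne'
  have hric := NullCongruence.sum_mul_riemann (G := G) (h.smooth u hu c)
    (h.differentiableAt_negHessian hu c)
    (fun l i j => (contDiffAt_christoffel hG (h.contDiffAt_metric hu) l i j).differentiableAt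
      (by simp))
    (fun i j => (h.eventually_mem hu).mono fun w hw => h.sum_mul_christoffel hw c i j) k i j
  rw [hric]
  have e2 := fun i j => h.sum_mul_christoffel hu 2 i j
  have e3 := fun i j => h.sum_mul_christoffel hu 3 i j
  have c2 := fun i j => h.closed u hu 2 i j
  have c3 := fun i j => h.closed u hu 3 i j
  simp only [Fin.sum_univ_four] at e2 e3 ⊢
  fin_cases c
  · simp [negHessian, show negHessian A r r' 0 = fun _ _ _ => 0 from rfl, partialDeriv_const]
  · simp [negHessian, show negHessian A r r' 1 = fun _ _ _ => 0 from rfl, partialDeriv_const]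
  · simp only [Fin.reduceFinMk, h.partialDeriv_negHessian_two hu]
    have a := e3 j k
    have b := e3 i k
    simp [negHessian, wedge] at a b ⊢
    rw [c3 j i]
    field_simp at a b ⊢
    linear_combination r' u * A 3 i u * a - r' u * A 3 j u * b
  · simp only [Fin.reduceFinMk, h.partialDeriv_negHessian_three hu]
    have a := e3 j k
    have b := e3 i k
    have a' := e2 j k
    have b' := e2 i k
    simp [negHessian, wedge] at a b a' b' ⊢
    rw [c3 j i, c2 j i]
    field_simp at a b a' b' ⊢
    linear_combination r' u * A 2 i u * a - r' u * A 2 j u * b + r' u * r u * A 3 i u * a'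
      - r' u * r u * A 3 j u * b'

/-- Lowering the index weights the coframe components by `1, 1, -1, r²`, and the two that survive
assemble into a second factor `a² ∧ a³`. This is the form required for `R · R = 0`. -/
lemma sum_metric_mul_riemann (h : IsWarpedCoframe U G A r r' r'') (hu : u ∈ U) (a k i j : Fin 4) :
    ∑ l, G u a l * riemann G l k i j u = r u * r'' u * (wedge A i j u * wedge A k a u) := by
  have h0 := (h.pos u hu).ne'
  have e0 := h.sum_mul_riemann hu 0 k i j
  have e1 := h.sum_mul_riemann hu 1 k i j
  have e2 := h.sum_mul_riemann hu 2 k i j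
  have e3 := h.sum_mul_riemann hu 3 k i j
  simp only [Fin.sum_univ_four, h.metric_eq u hu] at e0 e1 e2 e3 ⊢
  simp at e0 e1 e2 e3
  field_simp at e3
  simp only [wedge] at e2 e3 ⊢
  linear_combination A 0 a u * e0 + A 1 a u * e1 - A 2 a u * e2 + r u * A 3 a u * e3

lemma curvatureDotCurvature_eq_zero (h : IsWarpedCoframe U G A r r' r'') (hu : u ∈ U)
    (X₁ X₂ X₃ X₄ X Y : Fin 4 → ℝ) : curvatureDotCurvature G u X₁ X₂ X₃ X₄ X Y = 0 :=
  NullCongruence.curvatureDotCurvature_eq_zero (h.isUnit_det hu) (h.metric_symm hu)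
    (Ω := fun i j => wedge A i j u) (fun i j => by simp only [wedge]; ring)
    (h.sum_metric_mul_riemann hu) X₁ X₂ X₃ X₄ X Y

end IsWarpedCoframe

/-! ### Orthonormal frames of Minkowski space. -/

section Minkowski

lemma metric_minkowski (p X Y : Fin 3 → ℝ) :
    metric minkowski p X Y = X 0 * Y 0 + X 1 * Y 1 - X 2 * Y 2 := by
  simp [metric, minkowski, Fin.sum_univ_three]
  ring

lemma christoffelVec_minkowski (p X Y : Fin 3 → ℝ) : christoffelVec minkowski p X Y = 0 := by
  ext l
  simp [christoffelVec, christoffel, minkowski, partialDeriv_const]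

lemma covDeriv_minkowski (Y : (Fin 3 → ℝ) → (Fin 3 → ℝ)) (p X : Fin 3 → ℝ) :
    covDeriv minkowski Y p X = fderiv ℝ Y p X := by
  simp [covDeriv, christoffelVec_minkowski]

/-- The columns of `P` are an orthonormal basis of Minkowski space, timelike vector last, and `Q`
gives the coordinates in this basis. -/
structure IsLorentzFrame (P Q : Matrix (Fin 3) (Fin 3) ℝ) : Prop where
  mul_eq_one : P * Q = 1
  mul_eq_one' : Q * P = 1
  metric_eq : ∀ p X Y, metric minkowski p X Y = Q.mulVec X 0 * Q.mulVec Y 0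
    + Q.mulVec X 1 * Q.mulVec Y 1 - Q.mulVec X 2 * Q.mulVec Y 2

lemma isLorentzFrame_of_transpose {P : Matrix (Fin 3) (Fin 3) ℝ}
    (h : Matrix.diagonal ![1, 1, -1] * P.transpose * Matrix.diagonal ![1, 1, -1] * P = 1) :
    IsLorentzFrame P (Matrix.diagonal ![1, 1, -1] * P.transpose * Matrix.diagonal ![1, 1, -1]) := by
  have h' := mul_eq_one_comm.1 h
  refine ⟨h', h, fun p X Y => ?_⟩
  set η : Matrix (Fin 3) (Fin 3) ℝ := Matrix.diagonal ![1, 1, -1] with hη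
  have hηη : η * η = 1 := by
    rw [hη, Matrix.diagonal_mul_diagonal, ← Matrix.diagonal_one]
    congr 1
    ext i
    fin_cases i <;> simp
  have hηt : η.transpose = η := by simp [hη]
  have hform : ∀ X Y : Fin 3 → ℝ, dotProduct X (η.mulVec Y) = X 0 * Y 0 + X 1 * Y 1 - X 2 * Y 2 := by
    intro X Y
    simp [hη, Matrix.mulVec_diagonal, dotProduct, Fin.sum_univ_three]
    ring
  have e : (η * P.transpose * η).transpose * (η * (η * P.transpose * η)) = η := by
    calc (η * P.transpose * η).transpose * (η * (η * P.transpose * η))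
        = η * (P * (η * (η * η) * P.transpose * η)) := by
          simp [Matrix.transpose_mul, hηt, mul_assoc]
      _ = η := by rw [hηη, mul_one, h', mul_one]
  rw [metric_minkowski, ← hform, ← hform]
  conv_lhs => rw [← e]
  rw [← Matrix.mulVec_mulVec, Matrix.dotProduct_mulVec, Matrix.vecMul_transpose,
    Matrix.mulVec_mulVec]

lemma exists_isLorentzFrame (T : Fin 3 → ℝ) (hT : T 0 * T 0 + T 1 * T 1 - T 2 * T 2 = -1) :
    ∃ P Q, IsLorentzFrame P Q ∧ Q.mulVec T = ![0, 0, 1] := by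
  set s := √(1 + T 1 ^ 2) with hs
  have hs2 : s ^ 2 = 1 + T 1 ^ 2 := Real.sq_sqrt (by positivity)
  have hs0 : s ≠ 0 := (Real.sqrt_pos.2 (by positivity)).ne'
  -- The last column is `T`. The middle one is the normalized projection `∂_y + T 1 • T` of `∂_y` to
  -- the orthogonal complement of `T`. The first is orthogonal to both `T` and `∂_y`. No time
  -- orientation of `T` is needed.
  set P : Matrix (Fin 3) (Fin 3) ℝ := !![T 2 / s, T 0 * T 1 / s, T 0;
    0, (1 + T 1 ^ 2) / s, T 1; T 0 / s, T 2 * T 1 / s, T 2] with hP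
  have h : Matrix.diagonal ![1, 1, -1] * P.transpose * Matrix.diagonal ![1, 1, -1] * P = 1 := by
    ext i j
    fin_cases i <;> fin_cases j <;>
      simp [Matrix.mul_apply, Matrix.diagonal_apply, Fin.sum_univ_three, hP] <;> field_simp
    · linear_combination -hT - hs2
    · ring
    · ring
    · ring
    · linear_combination T 1 ^ 2 * hT - hs2
    · linear_combination T 1 * hT
    · ring
    · linear_combination -T 1 * hT
    · linear_combination -hT
  have hf := isLorentzFrame_of_transpose h
  refine ⟨_, _, hf, ?_⟩
  have hT' : P.mulVec ![0, 0, 1] = T := by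
    ext i
    fin_cases i <;> simp [hP, Matrix.mulVec, dotProduct, Fin.sum_univ_three]
  conv_lhs => rw [← hT']
  rw [Matrix.mulVec_mulVec, hf.mul_eq_one', Matrix.one_mulVec]

end Minkowski

/-! ### Normal form of the vector field. -/

section RecurrentField

/-- Equal logarithmic derivatives `ℓ` make the quotient have zero derivative. It is applied to the
components of `K` and to the length of `K`. -/
lemma div_const_of_hasFDerivAt {E : Type} [NormedAddCommGroup E] [NormedSpace ℝ E]
    {F S : E → ℝ} {ℓ : E → E →L[ℝ] ℝ} (hF : ∀ p, HasFDerivAt F (F p • ℓ p) p)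
    (hS : ∀ p, HasFDerivAt S (S p • ℓ p) p) (h0 : ∀ p, S p ≠ 0) (p q : E) :
    F p / S p = F q / S q := by
  have h : ∀ p, HasFDerivAt (fun p => F p * (S p)⁻¹) (0 : E →L[ℝ] ℝ) p := by
    intro p
    have h1 := (hF p).mul ((hasDerivAt_inv (h0 p)).comp_hasFDerivAt p (hS p))
    refine h1.congr_fderiv ?_
    ext X
    have := h0 p
    simp
    field_simp
    ring
  exact is_const_of_fderiv_eq_zero (𝕜 := ℝ) (fun p => (h p).differentiableAt)
    (fun p => (h p).fderiv) p q

/-- A timelike field with `∇K = α K♭ ⊗ K` is, in a suitable orthonormal frame, the field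
`(1 / f(t)) ∂ₜ`, and `α = f'(t)`. -/
lemma exists_frame_of_recurrent (K : (Fin 3 → ℝ) → (Fin 3 → ℝ)) (hK : ContDiff ℝ ∞ K)
    (hKtimelike : ∀ p, metric minkowski p (K p) (K p) < 0) (α : (Fin 3 → ℝ) → ℝ)
    (hnabla : ∀ p X, covDeriv minkowski K p X = (α p * metric minkowski p (K p) X) • K p) :
    ∃ (P Q : Matrix (Fin 3) (Fin 3) ℝ) (f : ℝ → ℝ), IsLorentzFrame P Q ∧ ContDiff ℝ ∞ f ∧
      (∀ s, 0 < f s) ∧ (∀ p, Q.mulVec (K p) = ![0, 0, 1 / f (Q.mulVec p 2)]) ∧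
      ∀ p, α p = deriv f (Q.mulVec p 2) := by
  set ℓ : (Fin 3 → ℝ) → (Fin 3 → ℝ) →L[ℝ] ℝ := fun p => α p •
    (K p 0 • ContinuousLinearMap.proj 0 + K p 1 • ContinuousLinearMap.proj 1
      - K p 2 • ContinuousLinearMap.proj 2) with hℓ
  have hℓ' : ∀ p X, ℓ p X = α p * metric minkowski p (K p) X := by
    intro p X
    simp [hℓ, metric_minkowski]
  have hKi : ∀ i p, HasFDerivAt (fun p => K p i) (K p i • ℓ p) p := by
    intro i p
    have h1 : HasFDerivAt K (fderiv ℝ K p) p := (hK.differentiable (by simp) p).hasFDerivAt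
    refine (hasFDerivAt_pi'.1 h1 i).congr_fderiv ?_
    ext X
    have := congrFun (hnabla p X) i
    rw [covDeriv_minkowski] at this
    simp only [ContinuousLinearMap.comp_apply, ContinuousLinearMap.proj_apply, this, hℓ',
      smul_apply, Pi.smul_apply, smul_eq_mul]
    ring
  have hKs : ∀ i, ContDiff ℝ ∞ (fun p => K p i) := contDiff_pi.1 hK
  set h : (Fin 3 → ℝ) → ℝ := fun p => K p 2 * K p 2 - K p 0 * K p 0 - K p 1 * K p 1 with hh
  have hpos : ∀ p, 0 < h p := by
    intro p
    have := hKtimelike p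
    rw [metric_minkowski] at this
    simp only [hh]; linarith
  have hhd : ∀ p, HasFDerivAt h ((2 * h p) • ℓ p) p := by
    intro p
    refine ((((hKi 2 p).mul (hKi 2 p)).sub ((hKi 0 p).mul (hKi 0 p))).sub
      ((hKi 1 p).mul (hKi 1 p))).congr_fderiv ?_
    ext X
    simp [hh]
    ring
  set S : (Fin 3 → ℝ) → ℝ := fun p => √(h p) with hS
  have hSpos : ∀ p, 0 < S p := fun p => Real.sqrt_pos.2 (hpos p)
  have hSS : ∀ p, S p * S p = h p := fun p => Real.mul_self_sqrt (hpos p).le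
  have hSd : ∀ p, HasFDerivAt S (S p • ℓ p) p := by
    intro p
    refine ((hhd p).sqrt (hpos p).ne').congr_fderiv ?_
    ext X
    have h0 := (hSpos p).ne'
    have h1 := hSS p
    change (1 / (2 * S p)) * (2 * h p * ℓ p X) = S p * ℓ p X
    rw [← h1]
    field_simp
  have hSs : ContDiff ℝ ∞ S := by
    have : ContDiff ℝ ∞ h := (((hKs 2).mul (hKs 2)).sub ((hKs 0).mul (hKs 0))).sub
      ((hKs 1).mul (hKs 1))
    exact this.sqrt fun p => (hpos p).ne'
  set T : Fin 3 → ℝ := fun i => K 0 i / S 0 with hT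
  have hKT : ∀ p, K p = S p • T := by
    intro p
    ext i
    have h1 := div_const_of_hasFDerivAt (hKi i) hSd (fun p => (hSpos p).ne') p 0
    simp only [Pi.smul_apply, hT, ← h1, smul_eq_mul]
    have := (hSpos p).ne'
    field_simp
  have hTT : T 0 * T 0 + T 1 * T 1 - T 2 * T 2 = -1 := by
    have h1 := hSS 0
    have h0 := (hSpos 0).ne'
    simp only [hT, hh] at h1 ⊢
    field_simp
    linear_combination h1
  obtain ⟨P, Q, hPQ, hQT⟩ := exists_isLorentzFrame T hTT
  set q : (Fin 3 → ℝ) →L[ℝ] ℝ :=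
    (ContinuousLinearMap.proj 2).comp (LinearMap.toContinuousLinearMap Q.mulVecLin) with hq
  have hq' : ∀ p, q p = Q.mulVec p 2 := fun p => by simp [hq]
  have hqT : q T = 1 := by rw [hq', hQT]; simp
  have hQK : ∀ p, Q.mulVec (K p) = ![0, 0, S p] := by
    intro p
    rw [hKT, Matrix.mulVec_smul, hQT]
    ext i; fin_cases i <;> simp
  set F : (Fin 3 → ℝ) → ℝ := fun p => (S p)⁻¹ with hF
  -- Here `d(1 / S) = -ℓ / S = -α g(T, ·)`, and `g(T, ·) = -q` because `T` is the timelike frame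
  -- vector.
  have hFd : ∀ p, HasFDerivAt F (α p • q) p := by
    intro p
    refine ((hasDerivAt_inv (hSpos p).ne').comp_hasFDerivAt p (hSd p)).congr_fderiv ?_
    ext X
    have h0 := (hSpos p).ne'
    simp [hℓ', hPQ.metric_eq, hQK, hq']
    field_simp
  have hFs : ContDiff ℝ ∞ F := hSs.inv fun p => (hSpos p).ne'
  set f : ℝ → ℝ := fun s => F (s • T) with hf
  have hFf : ∀ p, F p = f (q p) := by
    intro p
    -- The segment from `q(p) T` to `p` lies in a level set of `q`, since `q(T) = 1`, so `F` is
    -- constant along it.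
    have h1 : ∀ s : ℝ, HasDerivAt (fun s : ℝ => F (q p • T + s • (p - q p • T))) 0 s := by
      intro s
      have h2 : HasDerivAt (fun s : ℝ => q p • T + s • (p - q p • T)) (p - q p • T) s := by
        simpa using ((hasDerivAt_id s).smul_const (p - q p • T)).const_add (q p • T)
      have h3 := (hFd (q p • T + s • (p - q p • T))).comp_hasDerivAt s h2
      refine h3.congr_deriv ?_
      simp [hqT]
    have h4 := is_const_of_deriv_eq_zero (fun s => (h1 s).differentiableAt) (fun s => (h1 s).deriv)
      1 0
    simpa [hf] using h4
  have hfs : ContDiff ℝ ∞ f := hFs.comp (contDiff_id.smul contDiff_const)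
  refine ⟨P, Q, f, hPQ, hfs, fun s => inv_pos.2 (hSpos _), fun p => ?_, fun p => ?_⟩
  · rw [hQK, ← hq', ← hFf]
    simp [hF]
  · have hfd : HasDerivAt f (deriv f (q p)) (q p) :=
      (hfs.differentiable (by simp) _).hasDerivAt
    have h1 := hfd.comp_hasFDerivAt p q.hasFDerivAt
    have h2 : F = f ∘ q := funext hFf
    rw [← h2] at h1
    have := congrArg (fun L => L T) (h1.unique (hFd p))
    rw [← hq']
    simpa [hqT] using this.symm

end RecurrentField

/-! ### The warped coframe built from position and velocity functions. -/

lemma fderiv_eq_sum_partialDeriv {ι : Type} [Fintype ι] [DecidableEq ι] (f : (ι → ℝ) → ℝ)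
    (u w : ι → ℝ) : fderiv ℝ f u w = ∑ i, partialDeriv i f u * w i := by
  conv_lhs => rw [pi_eq_sum_univ' w]
  simp only [map_sum, map_smul, smul_eq_mul, partialDeriv, mul_comm]

/-- The coframe `dx⁰, dx¹, dx², (b₀ db₁ - b₁ db₀) / r²`. -/
def angularCoframe (x : Fin 3 → (Fin 4 → ℝ) → ℝ) (r b₀ b₁ : (Fin 4 → ℝ) → ℝ) (c i : Fin 4)
    (u : Fin 4 → ℝ) : ℝ :=
  ![partialDeriv i (x 0) u, partialDeriv i (x 1) u, partialDeriv i (x 2) u,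
    (b₀ u * partialDeriv i b₁ u - b₁ u * partialDeriv i b₀ u) / (r u * r u)] c

/-- With `(b₀, b₁) = r (cos θ, sin θ)`, the last form is `dθ`, written without choosing an angle. It
is thus defined in every chart, including those on which no continuous `θ` exists. -/
lemma isWarpedCoframe_angularCoframe {U : Set (Fin 4 → ℝ)} (hU : IsOpen U)
    {G : (Fin 4 → ℝ) → Matrix (Fin 4) (Fin 4) ℝ} {x : Fin 3 → (Fin 4 → ℝ) → ℝ}
    {b₀ b₁ : (Fin 4 → ℝ) → ℝ} {f : ℝ → ℝ} (hx : ∀ u ∈ U, ∀ c, ContDiffAt ℝ ∞ (x c) u)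
    (hb₀ : ∀ u ∈ U, ContDiffAt ℝ ∞ b₀ u) (hb₁ : ∀ u ∈ U, ContDiffAt ℝ ∞ b₁ u)
    (hf : ContDiff ℝ ∞ f) (hpos : ∀ s, 0 < f s)
    (hcirc : ∀ u ∈ U, b₀ u * b₀ u + b₁ u * b₁ u = f (x 2 u) * f (x 2 u))
    (hinj : ∀ u ∈ U, ∀ w, (∀ c, fderiv ℝ (x c) u w = 0) → fderiv ℝ b₀ u w = 0 →
      fderiv ℝ b₁ u w = 0 → w = 0)
    (hG : ∀ u ∈ U, ∀ i j, G u i j = partialDeriv i (x 0) u * partialDeriv j (x 0) u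
      + partialDeriv i (x 1) u * partialDeriv j (x 1) u
      - partialDeriv i (x 2) u * partialDeriv j (x 2) u
      + (partialDeriv i b₀ u * partialDeriv j b₀ u + partialDeriv i b₁ u * partialDeriv j b₁ u
      - (deriv f (x 2 u) * partialDeriv i (x 2) u) * (deriv f (x 2 u) * partialDeriv j (x 2) u))) :
    IsWarpedCoframe U G (angularCoframe x (fun u => f (x 2 u)) b₀ b₁) (fun u => f (x 2 u))
      (fun u => deriv f (x 2 u)) (fun u => deriv (deriv f) (x 2 u)) := by
  have hf' : ContDiff ℝ ∞ (deriv f) := ((contDiff_infty_iff_deriv (𝕜 := ℝ)).1 hf).2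
  have hr : ∀ u ∈ U, ContDiffAt ℝ ∞ (fun u => f (x 2 u)) u :=
    fun u hu => hf.contDiffAt.comp u (hx u hu 2)
  have hdr : ∀ u ∈ U, ∀ i, partialDeriv i (fun u => f (x 2 u)) u
      = deriv f (x 2 u) * partialDeriv i (x 2) u := fun u hu i =>
    partialDeriv_comp (hf.differentiable (by simp) _) ((hx u hu 2).differentiableAt (by simp)) i
  have hE : ∀ u ∈ U, ∀ i, b₀ u * partialDeriv i b₀ u + b₁ u * partialDeriv i b₁ u
      = f (x 2 u) * (deriv f (x 2 u) * partialDeriv i (x 2) u) := by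
    intro u hu i
    have h0 := (hb₀ u hu).differentiableAt (by simp)
    have h1 := (hb₁ u hu).differentiableAt (by simp)
    have h2 := (hr u hu).differentiableAt (by simp)
    have := partialDeriv_congr (u := u) (f := fun u => b₀ u * b₀ u + b₁ u * b₁ u)
      (g := fun u => f (x 2 u) * f (x 2 u))
      (Filter.Eventually.mono (hU.mem_nhds hu) fun w hw => hcirc w hw) i
    rw [partialDeriv_add (h0.fun_mul h0) (h1.fun_mul h1), partialDeriv_mul h0 h0,
      partialDeriv_mul h1 h1, partialDeriv_mul h2 h2, hdr u hu] at this
    linear_combination this / 2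
  refine ⟨hU, fun u hu c i => ?_, hr, fun u hu => hf'.contDiffAt.comp u (hx u hu 2),
    fun u _ => hpos _, fun u hu c i j => ?_, hdr, fun u hu i => ?_, fun u hu => ?_,
    fun u hu i j => ?_⟩
  · have h3 : ContDiffAt ℝ ∞ (fun u => (b₀ u * partialDeriv i b₁ u - b₁ u * partialDeriv i b₀ u)
        / (f (x 2 u) * f (x 2 u))) u :=
      (((hb₀ u hu).mul (contDiffAt_partialDeriv (hb₁ u hu) i)).sub
        ((hb₁ u hu).mul (contDiffAt_partialDeriv (hb₀ u hu) i))).div ((hr u hu).mul (hr u hu))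
        (mul_pos (hpos _) (hpos _)).ne'
    fin_cases c
    · exact contDiffAt_partialDeriv (hx u hu 0) i
    · exact contDiffAt_partialDeriv (hx u hu 1) i
    · exact contDiffAt_partialDeriv (hx u hu 2) i
    · exact h3
  -- Closedness of the angular form. The denominator is differentiated through `d(r²) = 2 (b₀ db₀ +
  -- b₁ db₁)`, after which antisymmetrization and `b₀² + b₁² = r²` finish.
  · have hω : ∀ i j, partialDeriv i (fun u => (b₀ u * partialDeriv j b₁ u
          - b₁ u * partialDeriv j b₀ u) / (f (x 2 u) * f (x 2 u))) u
        = ((partialDeriv i b₀ u * partialDeriv j b₁ u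
            + b₀ u * partialDeriv i (partialDeriv j b₁) u
            - (partialDeriv i b₁ u * partialDeriv j b₀ u
            + b₁ u * partialDeriv i (partialDeriv j b₀) u)) * (f (x 2 u) * f (x 2 u))
          - (b₀ u * partialDeriv j b₁ u - b₁ u * partialDeriv j b₀ u)
            * (2 * (b₀ u * partialDeriv i b₀ u + b₁ u * partialDeriv i b₁ u)))
          / (f (x 2 u) * f (x 2 u)) ^ 2 := by
      intro i j
      have h0 := (hb₀ u hu).differentiableAt (by simp)
      have h1 := (hb₁ u hu).differentiableAt (by simp)
      have h2 := (hr u hu).differentiableAt (by simp)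
      have h0' := (contDiffAt_partialDeriv (hb₀ u hu) j).differentiableAt (by simp)
      have h1' := (contDiffAt_partialDeriv (hb₁ u hu) j).differentiableAt (by simp)
      rw [partialDeriv_div ((h0.fun_mul h1').fun_sub (h1.fun_mul h0')) (h2.fun_mul h2)
        (mul_pos (hpos _) (hpos _)).ne', partialDeriv_sub (h0.fun_mul h1') (h1.fun_mul h0'),
        partialDeriv_mul h0 h1', partialDeriv_mul h1 h0', partialDeriv_mul h2 h2, hdr u hu, hE u hu]
      ring
    have h3 : partialDeriv i (fun u => (b₀ u * partialDeriv j b₁ u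
          - b₁ u * partialDeriv j b₀ u) / (f (x 2 u) * f (x 2 u))) u
        = partialDeriv j (fun u => (b₀ u * partialDeriv i b₁ u
          - b₁ u * partialDeriv i b₀ u) / (f (x 2 u) * f (x 2 u))) u := by
      rw [hω, hω, partialDeriv_comm (hb₀ u hu) i j, partialDeriv_comm (hb₁ u hu) i j]
      congr 1
      linear_combination -2 * (partialDeriv i b₀ u * partialDeriv j b₁ u
        - partialDeriv i b₁ u * partialDeriv j b₀ u) * hcirc u hu
    fin_cases c
    · exact partialDeriv_comm (hx u hu 0) i j
    · exact partialDeriv_comm (hx u hu 1) i j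
    · exact partialDeriv_comm (hx u hu 2) i j
    · exact h3
  · exact partialDeriv_comp (hf'.differentiable (by simp) _)
      ((hx u hu 2).differentiableAt (by simp)) i
  · rw [← Matrix.isUnit_iff_isUnit_det, ← Matrix.mulVec_injective_iff_isUnit]
    refine (injective_iff_map_eq_zero (Matrix.mulVecLin (Matrix.of fun c i =>
      angularCoframe x (fun u => f (x 2 u)) b₀ b₁ c i u))).2 fun w hw => ?_
    have hc : ∀ c, ∑ i, angularCoframe x (fun u => f (x 2 u)) b₀ b₁ c i u * w i = 0 :=
      fun c => congrFun hw c
    have e0 : fderiv ℝ (x 0) u w = 0 := (fderiv_eq_sum_partialDeriv _ _ _).trans (hc 0)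
    have e1 : fderiv ℝ (x 1) u w = 0 := (fderiv_eq_sum_partialDeriv _ _ _).trans (hc 1)
    have e2 : fderiv ℝ (x 2) u w = 0 := (fderiv_eq_sum_partialDeriv _ _ _).trans (hc 2)
    have hp := (mul_pos (hpos (x 2 u)) (hpos (x 2 u))).ne'
    have e3 : b₀ u * fderiv ℝ b₁ u w - b₁ u * fderiv ℝ b₀ u w = 0 := by
      have h := hc 3
      simp only [angularCoframe, Matrix.cons_val, div_mul_eq_mul_div] at h
      rw [← Finset.sum_div, div_eq_zero_iff, or_iff_left hp] at h
      rw [fderiv_eq_sum_partialDeriv, fderiv_eq_sum_partialDeriv, Finset.mul_sum, Finset.mul_sum,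
        ← Finset.sum_sub_distrib, ← h]
      exact Finset.sum_congr rfl fun i _ => by ring
    -- With `e3` this says that `(db₀(w), db₁(w))` has no angular and no radial part, the latter
    -- because `dr` is a multiple of `dx²`, which kills `w`. Since `r ≠ 0`, both differentials
    -- vanish on `w`.
    have e4 : b₀ u * fderiv ℝ b₀ u w + b₁ u * fderiv ℝ b₁ u w = 0 := by
      have h : f (x 2 u) * (deriv f (x 2 u) * fderiv ℝ (x 2) u w) = 0 := by rw [e2]; ring
      rw [← h, fderiv_eq_sum_partialDeriv, fderiv_eq_sum_partialDeriv, fderiv_eq_sum_partialDeriv]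
      simp only [Finset.mul_sum, ← Finset.sum_add_distrib]
      exact Finset.sum_congr rfl fun i _ => by linear_combination w i * hE u hu i
    rw [← hcirc u hu] at hp
    refine hinj u hu w (fun c => by fin_cases c <;> assumption) ?_ ?_
    · refine (mul_eq_zero.1 ?_).resolve_left hp
      linear_combination b₀ u * e4 - b₁ u * e3
    · refine (mul_eq_zero.1 ?_).resolve_left hp
      linear_combination b₁ u * e4 + b₀ u * e3
  -- Polar coordinates: `db₀² + db₁² = dr² + r² dθ²`, so the term `-dr²` of the Sasaki metric
  -- cancels.
  · have hp := (hpos (x 2 u)).ne'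
    rw [hG u hu]
    simp only [angularCoframe, Matrix.cons_val]
    have hi := hE u hu i
    have hj := hE u hu j
    have hc := hcirc u hu
    generalize deriv f (x 2 u) * partialDeriv i (x 2) u = ri at *
    generalize deriv f (x 2 u) * partialDeriv j (x 2) u = rj at *
    generalize partialDeriv i b₀ u = p at *
    generalize partialDeriv i b₁ u = p' at *
    generalize partialDeriv j b₀ u = q at *
    generalize partialDeriv j b₁ u = q' at *
    field_simp
    linear_combination (-(p * q + p' * q')) * hc + (b₀ u * q + b₁ u * q') * hi + f (x 2 u) * ri * hj

/-! ### The null congruence in frame coordinates. -/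

/-- The coordinates of the base point in the frame with coordinate matrix `Q`. -/
def posCoord (Q : Matrix (Fin 3) (Fin 3) ℝ) (i : Fin 3) : (Fin 3 → ℝ) × (Fin 3 → ℝ) →L[ℝ] ℝ :=
  ((ContinuousLinearMap.proj i).comp (LinearMap.toContinuousLinearMap Q.mulVecLin)).comp
    (ContinuousLinearMap.fst ℝ _ _)

/-- The coordinates of the tangent vector in the frame with coordinate matrix `Q`. -/
def velCoord (Q : Matrix (Fin 3) (Fin 3) ℝ) (i : Fin 3) : (Fin 3 → ℝ) × (Fin 3 → ℝ) →L[ℝ] ℝ :=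
  ((ContinuousLinearMap.proj i).comp (LinearMap.toContinuousLinearMap Q.mulVecLin)).comp
    (ContinuousLinearMap.snd ℝ _ _)

lemma posCoord_apply (Q : Matrix (Fin 3) (Fin 3) ℝ) (i : Fin 3) (z : (Fin 3 → ℝ) × (Fin 3 → ℝ)) :
    posCoord Q i z = Q.mulVec z.1 i := by simp [posCoord]

lemma velCoord_apply (Q : Matrix (Fin 3) (Fin 3) ℝ) (i : Fin 3) (z : (Fin 3 → ℝ) × (Fin 3 → ℝ)) :
    velCoord Q i z = Q.mulVec z.2 i := by simp [velCoord]

/-- In the orthonormal frame given by `P` and `Q`, the field `K` is `(1 / f(t)) ∂ₜ`. -/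
structure IsAdapted (K : (Fin 3 → ℝ) → (Fin 3 → ℝ)) (P Q : Matrix (Fin 3) (Fin 3) ℝ)
    (f : ℝ → ℝ) : Prop where
  frame : IsLorentzFrame P Q
  smooth : ContDiff ℝ ∞ f
  pos : ∀ s, 0 < f s
  mulVec_eq : ∀ p, Q.mulVec (K p) = ![0, 0, 1 / f (Q.mulVec p 2)]

namespace IsAdapted

variable {K : (Fin 3 → ℝ) → (Fin 3 → ℝ)} {P Q : Matrix (Fin 3) (Fin 3) ℝ} {f : ℝ → ℝ}

lemma sasaki_eq (h : IsAdapted K P Q f) (z ζ ξ : (Fin 3 → ℝ) × (Fin 3 → ℝ)) :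
    sasaki minkowski z ζ ξ = posCoord Q 0 ζ * posCoord Q 0 ξ + posCoord Q 1 ζ * posCoord Q 1 ξ
      - posCoord Q 2 ζ * posCoord Q 2 ξ + (velCoord Q 0 ζ * velCoord Q 0 ξ
      + velCoord Q 1 ζ * velCoord Q 1 ξ - velCoord Q 2 ζ * velCoord Q 2 ξ) := by
  simp only [sasaki, connector, christoffelVec_minkowski, add_zero, h.frame.metric_eq,
    posCoord_apply, velCoord_apply]

/-- In the frame `g(v, K) = -v₂ / f(t)`, so the normalization fixes `v₂ = f(t)` and nullity becomes
a circle of radius `f(t)`. -/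
lemma mem_iff (h : IsAdapted K P Q f) (z : (Fin 3 → ℝ) × (Fin 3 → ℝ)) :
    z ∈ nullCongruence minkowski K ↔ velCoord Q 0 z * velCoord Q 0 z
      + velCoord Q 1 z * velCoord Q 1 z = f (posCoord Q 2 z) * f (posCoord Q 2 z) ∧
      velCoord Q 2 z = f (posCoord Q 2 z) := by
  have hp := (h.pos (Q.mulVec z.1 2)).ne'
  simp only [nullCongruence, Set.mem_ofPred_eq, h.frame.metric_eq, posCoord_apply, velCoord_apply,
    h.mulVec_eq, Matrix.cons_val]
  constructor
  · rintro ⟨h1, h2⟩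
    have h3 : Q.mulVec z.2 2 = f (Q.mulVec z.1 2) := by
      field_simp at h2
      linarith
    rw [h3] at h1
    exact ⟨by linarith, h3⟩
  · rintro ⟨h1, h2⟩
    rw [h1, h2]
    constructor
    · ring
    · field_simp
      ring

lemma ext_coord (h : IsAdapted K P Q f) {z z' : (Fin 3 → ℝ) × (Fin 3 → ℝ)}
    (hp : ∀ i, posCoord Q i z = posCoord Q i z') (hv : ∀ i, velCoord Q i z = velCoord Q i z') :
    z = z' := by
  have key : ∀ a b : Fin 3 → ℝ, Q.mulVec a = Q.mulVec b → a = b := by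
    intro a b hab
    have := congrArg P.mulVec hab
    simpa [Matrix.mulVec_mulVec, h.frame.mul_eq_one] using this
  refine Prod.ext (key _ _ (funext fun i => ?_)) (key _ _ (funext fun i => ?_))
  · simpa [posCoord_apply] using hp i
  · simpa [velCoord_apply] using hv i

lemma isWarpedCoframe (h : IsAdapted K P Q f)
    {e : OpenPartialHomeomorph (nullCongruence minkowski K) (Fin 4 → ℝ)}
    (he : IsSubmanifoldChart (nullCongruence minkowski K) e) :
    IsWarpedCoframe e.target
      (inducedMetric (sasaki minkowski) (nullCongruence minkowski K) e)
      (angularCoframe (fun c u => posCoord Q c (e.symm u)) (fun u => f (posCoord Q 2 (e.symm u)))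
        (fun u => velCoord Q 0 (e.symm u)) (fun u => velCoord Q 1 (e.symm u)))
      (fun u => f (posCoord Q 2 (e.symm u)))
      (fun u => deriv f (posCoord Q 2 (e.symm u)))
      (fun u => deriv (deriv f) (posCoord Q 2 (e.symm u))) := by
  set Φ : (Fin 4 → ℝ) → (Fin 3 → ℝ) × (Fin 3 → ℝ) := fun u => e.symm u with hΦ
  have hs : ∀ u ∈ e.target, ContDiffAt ℝ ∞ Φ u := fun u hu =>
    he.smooth.contDiffAt (e.open_target.mem_nhds hu)
  have hd : ∀ u ∈ e.target, DifferentiableAt ℝ Φ u := fun u hu =>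
    (hs u hu).differentiableAt (by simp)
  have hmem : ∀ u, Φ u ∈ nullCongruence minkowski K := fun u => (e.symm u).2
  have hL : ∀ (L : (Fin 3 → ℝ) × (Fin 3 → ℝ) →L[ℝ] ℝ), ∀ u ∈ e.target, ∀ w,
      fderiv ℝ (fun u => L (Φ u)) u w = L (fderiv ℝ Φ u w) := by
    intro L u hu w
    have := (L.hasFDerivAt.comp u (hd u hu).hasFDerivAt).fderiv
    change fderiv ℝ (L ∘ Φ) u w = _
    rw [this]; rfl
  have hLs : ∀ (L : (Fin 3 → ℝ) × (Fin 3 → ℝ) →L[ℝ] ℝ), ∀ u ∈ e.target,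
      ContDiffAt ℝ ∞ (fun u => L (Φ u)) u := fun L u hu => L.contDiff.contDiffAt.comp u (hs u hu)
  -- The time component of the velocity is `f(t)` on the congruence, so its differential is `f'(t)
  -- dt`. It therefore adds nothing to injectivity and contributes `-df²` to the metric.
  have hv2 : ∀ u ∈ e.target, ∀ w, velCoord Q 2 (fderiv ℝ Φ u w)
      = deriv f (posCoord Q 2 (Φ u)) * posCoord Q 2 (fderiv ℝ Φ u w) := by
    intro u hu w
    have h1 : (fun u => velCoord Q 2 (Φ u)) = fun u => f (posCoord Q 2 (Φ u)) :=
      funext fun u => ((h.mem_iff _).1 (hmem u)).2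
    have h2 : HasFDerivAt (fun u => f (posCoord Q 2 (Φ u))) _ u :=
      ((h.smooth.differentiable (by simp) (posCoord Q 2 (Φ u))).hasDerivAt).comp_hasFDerivAt
      u (((hLs (posCoord Q 2) u hu).differentiableAt (by simp)).hasFDerivAt)
    rw [← hL _ u hu, ← hL _ u hu, h1, h2.fderiv]
    rfl
  refine isWarpedCoframe_angularCoframe e.open_target (fun u hu c => hLs _ u hu) (hLs _) (hLs _)
    h.smooth h.pos (fun u _ => ((h.mem_iff _).1 (hmem u)).1) ?_ ?_
  · intro u hu w hx h0 h1
    rw [hL _ u hu] at h0 h1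
    have hx' : ∀ c, posCoord Q c (fderiv ℝ Φ u w) = 0 := fun c => by
      rw [← hL _ u hu]; exact hx c
    have h2 := hv2 u hu w
    rw [hx' 2, mul_zero] at h2
    refine he.immersion u hu (Eq.trans (h.ext_coord (z' := 0) (fun i => ?_) (fun i => ?_))
      (map_zero _).symm)
    · rw [map_zero]; exact hx' i
    · rw [map_zero]; fin_cases i <;> assumption
  · intro u hu i j
    have e1 : inducedMetric (sasaki minkowski) (nullCongruence minkowski K) e u i j
      = sasaki minkowski (Φ u) (fderiv ℝ Φ u (Pi.single i 1)) (fderiv ℝ Φ u (Pi.single j 1)) := rfl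
    rw [e1, h.sasaki_eq, hv2 u hu, hv2 u hu]
    simp only [← hL _ u hu]
    rfl

end IsAdapted

/-! ### Angular charts and the Lorentzian submanifold structure. -/

/-- A half-turn of the spatial plane moves the cut of `Complex.arg` to the opposite ray, so two
angular charts cover the congruence. -/
lemma IsLorentzFrame.rotate {P Q : Matrix (Fin 3) (Fin 3) ℝ} (h : IsLorentzFrame P Q) :
    IsLorentzFrame (P * Matrix.diagonal ![-1, -1, 1]) (Matrix.diagonal ![-1, -1, 1] * Q) := by
  set D : Matrix (Fin 3) (Fin 3) ℝ := Matrix.diagonal ![-1, -1, 1] with hD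
  have hDD : D * D = 1 := by
    rw [hD, Matrix.diagonal_mul_diagonal, ← Matrix.diagonal_one]
    congr 1
    ext i
    fin_cases i <;> simp
  refine ⟨?_, ?_, fun p X Y => ?_⟩
  · rw [mul_assoc, ← mul_assoc D D, hDD, one_mul, h.mul_eq_one]
  · rw [mul_assoc, ← mul_assoc Q, h.mul_eq_one', one_mul, hDD]
  · rw [h.metric_eq, ← Matrix.mulVec_mulVec, ← Matrix.mulVec_mulVec]
    simp [hD, Matrix.mulVec_diagonal]

/-- The parametrization of the null congruence by position in the frame `P` and angle. -/
def angleParam (P : Matrix (Fin 3) (Fin 3) ℝ) (f : ℝ → ℝ) (u : Fin 4 → ℝ) :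
    (Fin 3 → ℝ) × (Fin 3 → ℝ) :=
  (P.mulVec ![u 0, u 1, u 2],
    P.mulVec ![f (u 2) * Real.cos (u 3), f (u 2) * Real.sin (u 3), f (u 2)])

namespace IsAdapted

variable {K : (Fin 3 → ℝ) → (Fin 3 → ℝ)} {P Q : Matrix (Fin 3) (Fin 3) ℝ} {f : ℝ → ℝ}

lemma rotate (h : IsAdapted K P Q f) :
    IsAdapted K (P * Matrix.diagonal ![-1, -1, 1]) (Matrix.diagonal ![-1, -1, 1] * Q) f := by
  refine ⟨h.frame.rotate, h.smooth, h.pos, fun p => ?_⟩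
  rw [← Matrix.mulVec_mulVec, ← Matrix.mulVec_mulVec, h.mulVec_eq]
  ext i
  fin_cases i <;> simp [Matrix.mulVec_diagonal]

lemma posCoord_angleParam (h : IsAdapted K P Q f) (u : Fin 4 → ℝ) (i : Fin 3) :
    posCoord Q i (angleParam P f u) = ![u 0, u 1, u 2] i := by
  simp [posCoord_apply, angleParam, Matrix.mulVec_mulVec, h.frame.mul_eq_one']

lemma velCoord_angleParam (h : IsAdapted K P Q f) (u : Fin 4 → ℝ) (i : Fin 3) :
    velCoord Q i (angleParam P f u)
      = ![f (u 2) * Real.cos (u 3), f (u 2) * Real.sin (u 3), f (u 2)] i := by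
  simp [velCoord_apply, angleParam, Matrix.mulVec_mulVec, h.frame.mul_eq_one']

lemma angleParam_mem (h : IsAdapted K P Q f) (u : Fin 4 → ℝ) :
    angleParam P f u ∈ nullCongruence minkowski K := by
  rw [h.mem_iff]
  simp only [h.posCoord_angleParam, h.velCoord_angleParam, Matrix.cons_val, and_true]
  linear_combination f (u 2) ^ 2 * Real.sin_sq_add_cos_sq (u 3)

lemma contDiff_angleParam (h : IsAdapted K P Q f) : ContDiff ℝ ∞ (angleParam P f) := by
  have hf := h.smooth
  have hlin : ContDiff ℝ ∞ (fun v : Fin 3 → ℝ => P.mulVec v) :=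
    (LinearMap.toContinuousLinearMap P.mulVecLin).contDiff
  have h2 : ContDiff ℝ ∞ (fun u : Fin 4 → ℝ => f (u 2)) := hf.comp (contDiff_apply ℝ ℝ 2)
  have h3 : ContDiff ℝ ∞ (fun u : Fin 4 → ℝ => u 3) := contDiff_apply ℝ ℝ 3
  refine (hlin.comp (contDiff_pi.2 fun i => ?_)).prodMk (hlin.comp (contDiff_pi.2 fun i => ?_))
  · fin_cases i
    · exact contDiff_apply ℝ ℝ 0
    · exact contDiff_apply ℝ ℝ 1
    · exact contDiff_apply ℝ ℝ 2
  · fin_cases i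
    · exact h2.mul h3.cos
    · exact h2.mul h3.sin
    · exact h2

/-- The angular coordinates of a tangent vector. -/
def angleCoords (Q : Matrix (Fin 3) (Fin 3) ℝ) (z : (Fin 3 → ℝ) × (Fin 3 → ℝ)) : Fin 4 → ℝ :=
  ![posCoord Q 0 z, posCoord Q 1 z, posCoord Q 2 z, Complex.arg ⟨velCoord Q 0 z, velCoord Q 1 z⟩]

lemma norm_velCoord (h : IsAdapted K P Q f) {z : (Fin 3 → ℝ) × (Fin 3 → ℝ)}
    (hz : z ∈ nullCongruence minkowski K) :
    ‖(⟨velCoord Q 0 z, velCoord Q 1 z⟩ : ℂ)‖ = f (posCoord Q 2 z) := by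
  rw [Complex.norm_def, Complex.normSq_mk, ((h.mem_iff z).1 hz).1,
    Real.sqrt_mul_self (h.pos _).le]

lemma angleParam_angleCoords (h : IsAdapted K P Q f) {z : (Fin 3 → ℝ) × (Fin 3 → ℝ)}
    (hz : z ∈ nullCongruence minkowski K) : angleParam P f (angleCoords Q z) = z := by
  have hn := h.norm_velCoord hz
  refine h.ext_coord (fun i => ?_) (fun i => ?_)
  · rw [h.posCoord_angleParam]
    fin_cases i <;> simp [angleCoords]
  · rw [h.velCoord_angleParam]
    fin_cases i
    · simp [angleCoords, ← hn, Complex.norm_mul_cos_arg]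
    · simp [angleCoords, ← hn, Complex.norm_mul_sin_arg]
    · simp [angleCoords, ((h.mem_iff z).1 hz).2]

lemma velCoord_angleParam_complex (h : IsAdapted K P Q f) (u : Fin 4 → ℝ) :
    (⟨velCoord Q 0 (angleParam P f u), velCoord Q 1 (angleParam P f u)⟩ : ℂ)
      = f (u 2) * (Complex.cos (u 3) + Complex.sin (u 3) * Complex.I) := by
  rw [h.velCoord_angleParam, h.velCoord_angleParam]
  apply Complex.ext <;> simp [← Complex.ofReal_cos, ← Complex.ofReal_sin]

lemma angleCoords_angleParam (h : IsAdapted K P Q f) {u : Fin 4 → ℝ}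
    (hu : u 3 ∈ Set.Ioc (-Real.pi) Real.pi) : angleCoords Q (angleParam P f u) = u := by
  have harg : Complex.arg ⟨velCoord Q 0 (angleParam P f u), velCoord Q 1 (angleParam P f u)⟩
      = u 3 := by
    rw [h.velCoord_angleParam_complex, Complex.arg_mul_cos_add_sin_mul_I (h.pos _) hu]
  ext i
  fin_cases i <;> simp [angleCoords, harg, h.posCoord_angleParam]

lemma exists_angleChart (h : IsAdapted K P Q f) :
    ∃ e : OpenPartialHomeomorph (nullCongruence minkowski K) (Fin 4 → ℝ),
      (∀ u, (e.symm u : (Fin 3 → ℝ) × (Fin 3 → ℝ)) = angleParam P f u) ∧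
      (∀ u, u ∈ e.target ↔ u 3 ∈ Set.Ioo (-Real.pi) Real.pi) ∧
      ∀ z, z ∈ e.source ↔
        (⟨velCoord Q 0 z, velCoord Q 1 z⟩ : ℂ) ∈ Complex.slitPlane := by
  have hcont : Continuous fun z : nullCongruence minkowski K =>
      (⟨velCoord Q 0 z, velCoord Q 1 z⟩ : ℂ) := by
    have h1 : Continuous fun z : nullCongruence minkowski K =>
        ((velCoord Q 0 z : ℝ) : ℂ) + (velCoord Q 1 z : ℝ) * Complex.I := by fun_prop
    refine h1.congr fun z => ?_
    apply Complex.ext <;> simp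
  refine ⟨{
    toFun := fun z => angleCoords Q z
    invFun := fun u => ⟨angleParam P f u, h.angleParam_mem u⟩
    source := {z | (⟨velCoord Q 0 z, velCoord Q 1 z⟩ : ℂ) ∈ Complex.slitPlane}
    target := {u | u 3 ∈ Set.Ioo (-Real.pi) Real.pi}
    map_source' := ?_
    map_target' := ?_
    left_inv' := ?_
    right_inv' := ?_
    open_source := ?_
    open_target := ?_
    continuousOn_toFun := ?_
    continuousOn_invFun := ?_ }, fun u => rfl, fun u => Iff.rfl, fun z => Iff.rfl⟩
  · intro z hz
    have := Complex.arg_mem_Ioc ⟨velCoord Q 0 z, velCoord Q 1 z⟩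
    exact ⟨this.1, lt_of_le_of_ne this.2 (Complex.mem_slitPlane_iff_arg.1 hz).1⟩
  · intro u hu
    have harg := congrFun (h.angleCoords_angleParam (u := u) ⟨hu.1, hu.2.le⟩) 3
    simp only [angleCoords, Matrix.cons_val] at harg
    refine Complex.mem_slitPlane_iff_arg.2 ⟨?_, ?_⟩
    · change Complex.arg ⟨velCoord Q 0 (angleParam P f u), velCoord Q 1 (angleParam P f u)⟩ ≠ _
      rw [harg]; exact hu.2.ne
    · rw [← norm_ne_zero_iff, h.norm_velCoord (h.angleParam_mem u)]
      exact (h.pos _).ne'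
  · exact fun z _ => Subtype.ext (h.angleParam_angleCoords z.2)
  · exact fun u hu => h.angleCoords_angleParam ⟨hu.1, hu.2.le⟩
  · intro z hz
    refine ContinuousAt.continuousWithinAt (continuousAt_pi.2 fun i => ?_)
    fin_cases i
    · exact ((posCoord Q 0).continuous.comp continuous_subtype_val).continuousAt
    · exact ((posCoord Q 1).continuous.comp continuous_subtype_val).continuousAt
    · exact ((posCoord Q 2).continuous.comp continuous_subtype_val).continuousAt
    · exact (Complex.continuousAt_arg hz).comp (f := fun z : nullCongruence minkowski K =>
        (⟨velCoord Q 0 z, velCoord Q 1 z⟩ : ℂ)) hcont.continuousAt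
  · exact (h.contDiff_angleParam.continuous.subtype_mk _).continuousOn
  · exact Complex.isOpen_slitPlane.preimage hcont
  · exact isOpen_Ioo.preimage (continuous_apply 3)

lemma fderiv_angleParam_injective (h : IsAdapted K P Q f) (u : Fin 4 → ℝ) :
    Function.Injective (fderiv ℝ (angleParam P f) u) := by
  refine (injective_iff_map_eq_zero _).2 fun w hw => ?_
  have hd : HasFDerivAt (angleParam P f) (fderiv ℝ (angleParam P f) u) u :=
    (h.contDiff_angleParam.differentiable (by simp) u).hasFDerivAt
  have hL : ∀ (L : (Fin 3 → ℝ) × (Fin 3 → ℝ) →L[ℝ] ℝ) (g : (Fin 4 → ℝ) → ℝ)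
      (g' : (Fin 4 → ℝ) →L[ℝ] ℝ), (∀ u, L (angleParam P f u) = g u) → HasFDerivAt g g' u →
      g' w = 0 := by
    intro L g g' hg hg'
    have h1 := L.hasFDerivAt.comp u hd
    rw [show L ∘ angleParam P f = g from funext hg] at h1
    rw [← h1.unique hg']
    simp [hw]
  have hproj : ∀ i, HasFDerivAt (fun u : Fin 4 → ℝ => u i)
      (ContinuousLinearMap.proj (R := ℝ) i) u := fun i => hasFDerivAt_apply i u
  have h0 : w 0 = 0 := hL _ _ _ (fun u => h.posCoord_angleParam u 0) (hproj 0)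
  have h1 : w 1 = 0 := hL _ _ _ (fun u => h.posCoord_angleParam u 1) (hproj 1)
  have h2 : w 2 = 0 := hL _ _ _ (fun u => h.posCoord_angleParam u 2) (hproj 2)
  have hf := ((h.smooth.differentiable (by simp) (u 2)).hasDerivAt).comp_hasFDerivAt u (hproj 2)
  have h3 := hL _ _ _ (fun u => h.velCoord_angleParam u 0) (hf.mul (hproj 3).cos)
  have h4 := hL _ _ _ (fun u => h.velCoord_angleParam u 1) (hf.mul (hproj 3).sin)
  simp [h2] at h3 h4
  have hp := (h.pos (u 2)).ne'
  -- Once `w 2 = 0`, the velocity components give `f sin θ · w 3 = 0` and `f cos θ · w 3 = 0`. Sine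
  -- and cosine do not vanish together.
  have h5 : w 3 = 0 := by
    rcases h3 with h3 | h3 | h3
    · exact absurd h3 hp
    · rcases h4 with h4 | h4 | h4
      · exact absurd h4 hp
      · have := Real.sin_sq_add_cos_sq (u 3)
        simp [h3, h4] at this
      · exact h4
    · exact h3
  ext i
  fin_cases i <;> assumption

lemma isSubmanifoldChart (h : IsAdapted K P Q f)
    {e : OpenPartialHomeomorph (nullCongruence minkowski K) (Fin 4 → ℝ)}
    (he : ∀ u, (e.symm u : (Fin 3 → ℝ) × (Fin 3 → ℝ)) = angleParam P f u) :
    IsSubmanifoldChart (nullCongruence minkowski K) e := by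
  have he' := funext he
  refine ⟨?_, fun u _ => ?_⟩
  · rw [he']; exact h.contDiff_angleParam.contDiffOn
  · rw [he']; exact h.fderiv_angleParam_injective u

lemma isLorentzianSubmanifold (h : IsAdapted K P Q f) :
    IsLorentzianSubmanifold 4 (sasaki minkowski) (nullCongruence minkowski K) where
  connected := by
    have : nullCongruence minkowski K = Set.range (angleParam P f) := by
      ext z
      constructor
      · exact fun hz => ⟨_, h.angleParam_angleCoords hz⟩
      · rintro ⟨u, rfl⟩
        exact h.angleParam_mem u
    rw [this]
    exact isConnected_range h.contDiff_angleParam.continuous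
  exists_chart := by
    intro z
    by_cases hz : (⟨velCoord Q 0 z, velCoord Q 1 z⟩ : ℂ) ∈ Complex.slitPlane
    · obtain ⟨e, he, -, hs⟩ := h.exists_angleChart
      exact ⟨e, h.isSubmanifoldChart he, (hs z).2 hz⟩
    -- Outside the slit plane the spatial velocity lies on the nonpositive real axis. It is nonzero
    -- since its length is `f > 0`, so the half-turn sends it to the positive axis.
    · obtain ⟨e, he, -, hs⟩ := h.rotate.exists_angleChart
      refine ⟨e, h.rotate.isSubmanifoldChart he, (hs z).2 ?_⟩
      have hc := ((h.mem_iff z).1 z.2).1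
      have hp := h.pos (posCoord Q 2 z)
      rw [Complex.mem_slitPlane_iff] at hz ⊢
      simp only [velCoord_apply, ← Matrix.mulVec_mulVec, Matrix.mulVec_diagonal] at hz hc ⊢
      simp at hz hc ⊢
      left
      refine lt_of_le_of_ne hz.1 fun h0 => ?_
      rw [h0, hz.2] at hc
      nlinarith
  smooth_metric := fun e he i j u hu =>
    ((h.isWarpedCoframe he).contDiffAt_metric hu i j).contDiffWithinAt
  lorentz := fun e he u hu => (h.isWarpedCoframe he).isLorentzForm hu

lemma isSemiSymmetric (h : IsAdapted K P Q f) :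
    IsSemiSymmetric 4 (sasaki minkowski) (nullCongruence minkowski K) :=
  fun _ he _ hu => (h.isWarpedCoframe he).curvatureDotCurvature_eq_zero hu

end IsAdapted

/-! ### Failure of local symmetry. -/

namespace IsWarpedCoframe

variable {U : Set (Fin 4 → ℝ)} {G : (Fin 4 → ℝ) → Matrix (Fin 4) (Fin 4) ℝ}
  {A : Fin 4 → Fin 4 → (Fin 4 → ℝ) → ℝ} {r r' r'' : (Fin 4 → ℝ) → ℝ} {u : Fin 4 → ℝ}

/-- The given coefficient functions are controlled only on `U`. Literal constants have derivative
zero everywhere, which makes the explicit component computation possible. -/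
lemma to_one (h : IsWarpedCoframe U G A r r' r'')
    (hA : ∀ u ∈ U, ∀ c i, A c i u = (1 : Matrix (Fin 4) (Fin 4) ℝ) c i) :
    IsWarpedCoframe U G (fun c i _ => (1 : Matrix (Fin 4) (Fin 4) ℝ) c i) r r' r'' where
  isOpen := h.isOpen
  smooth _ _ _ _ := contDiffAt_const
  smooth_r := h.smooth_r
  smooth_r' := h.smooth_r'
  pos := h.pos
  closed _ _ _ _ _ := by rw [partialDeriv_const, partialDeriv_const]
  deriv_r u hu i := by rw [h.deriv_r u hu, hA u hu]
  deriv_r' u hu i := by rw [h.deriv_r' u hu, hA u hu]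
  indep u _ := by
    rw [show (Matrix.of fun c i => (1 : Matrix (Fin 4) (Fin 4) ℝ) c i) = 1 from rfl]
    simp
  metric_eq u hu i j := by rw [h.metric_eq u hu]; simp only [hA u hu]

/-- The component tests `∇_{∂ₜ} R` on the warped surface, where `R` is governed by `r'' / r`. The
value is `r²` times the derivative of that function. -/
lemma covDerivRiemann_eq
    (h : IsWarpedCoframe U G (fun c i _ => (1 : Matrix (Fin 4) (Fin 4) ℝ) c i) r r' r'')
    (hu : u ∈ U) (hr'' : DifferentiableAt ℝ r'' u) :
    covDerivRiemann G 2 2 3 2 3 u = r u * partialDeriv 2 r'' u - r' u * r'' u := by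
  have hr : DifferentiableAt ℝ r u := (h.smooth_r u hu).differentiableAt (by simp)
  have hp := (h.pos u hu).ne'
  have hΓ : ∀ l i j, christoffel G l i j u
      = negHessian (fun c i _ => (1 : Matrix (Fin 4) (Fin 4) ℝ) c i) r r' l i j u := by
    intro l i j
    have := h.sum_mul_christoffel hu l i j
    simpa [Matrix.one_apply, partialDeriv_const] using this
  have hR : ∀ w ∈ U, ∀ l k i j, riemann G l k i j w
      = wedge (fun c i _ => (1 : Matrix (Fin 4) (Fin 4) ℝ) c i) i j w *
        ![0, 0, r w * r'' w * (1 : Matrix (Fin 4) (Fin 4) ℝ) 3 k,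
          r'' w / r w * (1 : Matrix (Fin 4) (Fin 4) ℝ) 2 k] l := by
    intro w hw l k i j
    have := h.sum_mul_riemann hw l k i j
    simpa [Matrix.one_apply] using this
  have h1 : riemann G 2 3 2 3 =ᶠ[𝓝 u] fun w => r w * r'' w :=
    (h.eventually_mem hu).mono fun w hw => by simp [hR w hw, wedge]
  rw [covDerivRiemann, partialDeriv_congr h1, partialDeriv_mul hr hr'', h.deriv_r u hu]
  simp [Fin.sum_univ_four, hΓ, hR u hu, negHessian, wedge]
  field_simp
  ring

end IsWarpedCoframe

namespace IsAdapted

variable {K : (Fin 3 → ℝ) → (Fin 3 → ℝ)} {P Q : Matrix (Fin 3) (Fin 3) ℝ} {f : ℝ → ℝ}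

lemma not_isLocallySymmetric (h : IsAdapted K P Q f) {s : ℝ}
    (hs : f s * deriv (deriv (deriv f)) s - deriv f s * deriv (deriv f) s ≠ 0) :
    ¬ IsLocallySymmetric 4 (sasaki minkowski) (nullCongruence minkowski K) := by
  intro hloc
  obtain ⟨e, he, ht, -⟩ := h.exists_angleChart
  have hc := h.isSubmanifoldChart he
  have hw := h.isWarpedCoframe hc
  have hf' : ContDiff ℝ ∞ (deriv f) := ((contDiff_infty_iff_deriv (𝕜 := ℝ)).1 h.smooth).2
  have hf'' : ContDiff ℝ ∞ (deriv (deriv f)) := ((contDiff_infty_iff_deriv (𝕜 := ℝ)).1 hf').2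
  simp only [he, h.posCoord_angleParam, h.velCoord_angleParam, Matrix.cons_val] at hw
  have hd : ∀ u : Fin 4 → ℝ, ∀ i, DifferentiableAt ℝ (fun w : Fin 4 → ℝ => w i) u :=
    fun u i => differentiableAt_apply i u
  have hw1 := hw.to_one (by
    intro u hu c i
    have hfd : DifferentiableAt ℝ (fun w : Fin 4 → ℝ => f (w 2)) u :=
      (h.smooth.differentiable (by simp) _).comp u (hd u 2)
    have hp := (h.pos (u 2)).ne'
    fin_cases c
    · simp [angularCoframe, partialDeriv_apply, Matrix.one_apply, Pi.single_apply]
    · simp [angularCoframe, partialDeriv_apply, Matrix.one_apply, Pi.single_apply]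
    · simp [angularCoframe, partialDeriv_apply, Matrix.one_apply, Pi.single_apply]
    -- In the angular chart the last form is `du³`, by `cos² + sin² = 1`.
    · simp only [angularCoframe, Fin.reduceFinMk, Matrix.cons_val,
        partialDeriv_mul hfd (hd u 3).cos, partialDeriv_mul hfd (hd u 3).sin,
        partialDeriv_comp Real.differentiable_cos.differentiableAt (hd u 3),
        partialDeriv_comp Real.differentiable_sin.differentiableAt (hd u 3), Real.deriv_cos,
        Real.deriv_sin, partialDeriv_apply]
      have hsc := Real.sin_sq_add_cos_sq (u 3)
      rw [div_eq_iff (mul_ne_zero hp hp), show (1 : Matrix (Fin 4) (Fin 4) ℝ) _ i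
        = (Pi.single i 1 : Fin 4 → ℝ) 3 by simp [Matrix.one_apply, Pi.single_apply]]
      linear_combination f (u 2) ^ 2 * (Pi.single i 1 : Fin 4 → ℝ) 3 * hsc)
  -- Only the time coordinate `s` matters, and the angle 0 keeps the point inside the chart.
  set u : Fin 4 → ℝ := ![0, 0, s, 0] with hu
  have hut : u ∈ e.target := by
    rw [ht]
    simp [hu, Real.pi_pos]
  have h1 := hw1.covDerivRiemann_eq hut
    ((hf''.differentiable (by simp) _).comp u (hd u 2))
  rw [hloc e hc u hut 2 2 3 2 3, partialDeriv_comp (hf''.differentiable (by simp) _) (hd u 2),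
    partialDeriv_apply] at h1
  simp [hu] at h1
  exact hs h1.symm

/-- The function `K(K(α))` for `α = f'(t)`. -/
lemma vectorFieldAct_vectorFieldAct (h : IsAdapted K P Q f) {α : (Fin 3 → ℝ) → ℝ}
    (hα : ∀ p, α p = deriv f (Q.mulVec p 2)) (p : Fin 3 → ℝ) :
    vectorFieldAct K (vectorFieldAct K α) p
      = (f (Q.mulVec p 2) * deriv (deriv (deriv f)) (Q.mulVec p 2)
        - deriv f (Q.mulVec p 2) * deriv (deriv f) (Q.mulVec p 2)) / f (Q.mulVec p 2) ^ 3 := by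
  have hf' : ContDiff ℝ ∞ (deriv f) := ((contDiff_infty_iff_deriv (𝕜 := ℝ)).1 h.smooth).2
  have hf'' : ContDiff ℝ ∞ (deriv (deriv f)) := ((contDiff_infty_iff_deriv (𝕜 := ℝ)).1 hf').2
  have key : ∀ g : ℝ → ℝ, Differentiable ℝ g →
      vectorFieldAct K (fun p => g (Q.mulVec p 2))
        = fun p => deriv g (Q.mulVec p 2) / f (Q.mulVec p 2) := by
    intro g hg
    funext p
    set q : (Fin 3 → ℝ) →L[ℝ] ℝ :=
      (ContinuousLinearMap.proj 2).comp (LinearMap.toContinuousLinearMap Q.mulVecLin) with hq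
    have h1 := ((hg (q p)).hasDerivAt.comp_hasFDerivAt p q.hasFDerivAt).fderiv
    change fderiv ℝ (g ∘ q) p (K p) = _
    rw [h1]
    change deriv g (Q.mulVec p 2) * Q.mulVec (K p) 2 = _
    rw [h.mulVec_eq]
    simp
    rfl
  have hd2 : Differentiable ℝ (deriv (deriv f)) := hf''.differentiable (by simp)
  have hd0 : Differentiable ℝ f := h.smooth.differentiable (by simp)
  have h0 : ∀ s, f s ≠ 0 := fun s => (h.pos s).ne'
  rw [show α = fun p => deriv f (Q.mulVec p 2) from funext hα,
    key (deriv f) (hf'.differentiable (by simp)),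
    key (fun s => deriv (deriv f) s / f s) (hd2.fun_div hd0 h0)]
  simp only
  rw [deriv_fun_div (hd2 _) (hd0 _) (h0 _)]
  field_simp [h0 (Q.mulVec p 2)]

end IsAdapted

end NullCongruence

end

theorem mainTheorem3
    (K : (Fin 3 → ℝ) → (Fin 3 → ℝ)) (hK : ContDiff ℝ ∞ K)
    (hKtimelike : ∀ p, NullCongruence.metric NullCongruence.minkowski p (K p) (K p) < 0)
    (α : (Fin 3 → ℝ) → ℝ) (hα : ContDiff ℝ ∞ α)
    (hnabla : ∀ p X, NullCongruence.covDeriv NullCongruence.minkowski K p X =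
      (α p * NullCongruence.metric NullCongruence.minkowski p (K p) X) • K p) :
    NullCongruence.IsLorentzianSubmanifold 4
      (NullCongruence.sasaki NullCongruence.minkowski)
      (NullCongruence.nullCongruence NullCongruence.minkowski K) ∧
    NullCongruence.IsSemiSymmetric 4
      (NullCongruence.sasaki NullCongruence.minkowski)
      (NullCongruence.nullCongruence NullCongruence.minkowski K) ∧
    (NullCongruence.vectorFieldAct K (NullCongruence.vectorFieldAct K α) ≠ 0 →
      ¬ NullCongruence.IsLocallySymmetric 4
        (NullCongruence.sasaki NullCongruence.minkowski)
        (NullCongruence.nullCongruence NullCongruence.minkowski K)) := by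
  obtain ⟨P, Q, f, hPQ, hf, hpos, hQK, hαf⟩ :=
    NullCongruence.exists_frame_of_recurrent K hK hKtimelike α hnabla
  have h : NullCongruence.IsAdapted K P Q f := ⟨hPQ, hf, hpos, hQK⟩
  refine ⟨h.isLorentzianSubmanifold, h.isSemiSymmetric, fun hne => ?_⟩
  obtain ⟨p, hp⟩ := Function.ne_iff.1 hne
  rw [h.vectorFieldAct_vectorFieldAct hαf] at hp
  exact h.not_isLocallySymmetric (div_ne_zero_iff.1 hp).1
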